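/- Let $0<p<1$, $K\ge 1$, data points $x_1,\dots,x_K\in\mathbb R$ and $f:\mathbb R\to\mathbb R$. Let $\alpha_k=\cos\frac{(2k-1)\pi}{2K}$ $(1\le k\le K)$ be the encoder points and $\beta_n=\cos\frac{(n-1)\pi}{N-1}$ $(1\le n\le N)$ the decoder points, and put $\Omega=(-1,1)$. Each of $N$ servers is a straggler with probability $p$, independently of the others; $\mathcal F\subseteq\{1,\dots,N\}$ denotes the random set of non-stragglers. A scheme consists of an encoder function $u_{\rm enc}$ and, for each $\mathcal F$, a decoder function $u_{\rm dec}=u_{{\rm dec},\mathcal F}$ built from the values $f(u_{\rm enc}(\beta_v))$, $v\in\mathcal F$. Its approximation error is $\ell(\mathcal F)=\frac1K\sum_{k=1}^K\big(u_{\rm dec}(\alpha_k)-f(x_k)\big)^2$ and its average approximation error is $\mathcal L=\mathrm E_{\mathcal F}[\ell(\mathcal F)]$. (1) LeTCC. Let $K\ge2$, let $f$ be $\nu$-Lipschitz and twice differentiable with $|f''|\le\eta$. The encoder function minimizes $\frac1K\sum_k(u(\alpha_k)-x_k)^2+\lambda_{\rm enc}\int_\Omega (u'')^2$ over $u\in H^2(\Omega)$,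 and for $|\mathcal F|\ge2$ the decoder function minimizes $\frac1{|\mathcal F|}\sum_{v\in\mathcal F}\big(u(\beta_v)-f(u_{\rm enc}(\beta_v))\big)^2+\lambda_{\rm dec}\int_\Omega (u'')^2$ over $u\in H^2(\Omega)$, with $\lambda_{\rm enc},\lambda_{\rm dec}\ge0$; for a parameter equal to $0$ the minimizer with least $\int_\Omega(u'')^2$ is taken (the natural interpolating spline). If $|\mathcal F|<2$, the decoder function may be any $u\in H^2(\Omega)$ with $|u(\alpha_k)|\le M$ for all $k$, where $M$ is a fixed constant. Let $A$ be a constant. Then there are $C$ and $n_0$, depending only on $p,K,(x_k),f,\nu,\eta,A,M$, such that for all $N\ge n_0$, all $\lambda_{\rm dec}\le N^{-6}$ and all $\lambda_{\rm enc}\ge 0$, $$\mathcal L\le C\,\frac{\log_{1/p}^3(N)}{N^3}+\frac2K\sum_{k=1}^K\big(f(u_{\rm enc}(\alpha_k))-f(x_k)\big)^2,$$ and, if $\lambda_{\rm enc}\le A\log_{1/p}^3(N)/N^3$ (for instance $\lambda_{\rm enc}=0$), also $$\mathcal L\le C\,\frac{\log_{1/p}^3(N)}{N^3}.$$ Moreover,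 for every $\delta\in(0,1)$ there are $C$ and $n_0$, depending on the same data and on $\delta$, such that in the same situation each of these two bounds holds for $\ell(\mathcal F)$ in place of $\mathcal L$ with probability at least $1-\delta$. (2) BACC. Let $f\in C^2(\mathbb R)$. The encoder function is Berrut's rational interpolant of the data $(\alpha_k,x_k)$, $1\le k\le K$, and the decoder function is Berrut's rational interpolant of the data $(\beta_v,f(u_{\rm enc}(\beta_v)))$, $v\in\mathcal F$; here Berrut's interpolant of $(t_i,y_i)$, $i=1,\dots,m$, with $t_1>\dots>t_m$, is $z\mapsto\sum_i\frac{(-1)^i}{z-t_i}y_i\big/\sum_i\frac{(-1)^i}{z-t_i}$, with value $y_i$ at $t_i$ (and is $0$ for $m=0$). Then there are $C$ and $n_0$, depending only on $p,K,(x_k),f$, such that $\mathcal L\le C\log_{1/p}^4(N)/N^2$ for all $N\ge n_0$; and for every $\delta\in(0,1)$ there are $C$ and $n_0$, depending also on $\delta$, such that for all $N\ge n_0$, with probability at least $1-\delta$, $\ell(\mathcal F)\le C\log_{1/p}^4(N)/N^2$. (3) Let $\Delta_{\max}$ be the largest distance of consecutive points among the $\beta_n$ and the end points $\pm1$ of $\Omega$,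 and $\Delta_{\min}$ the smallest distance of consecutive $\beta_n$. Then $\Delta_{\max}/\Delta_{\min}=O(N)$ as $N\to\infty$, but $\Delta_{\max}/\Delta_{\min}\to\infty$, so that the ratio is not bounded. -/

import Mathlib

open Real Set Filter Topology MeasureTheory
open scoped NNReal ContDiff

noncomputable section

namespace CodedComputing

/-! ### The Sobolev space of second order on the interval `(-1, 1)` -/

/-- `v` is the weak derivative of `u` on the interval `(-1, 1)`. -/
def HasWeakDeriv (u v : ℝ → ℝ) : Prop :=
  ∀ φ : ℝ → ℝ, ContDiff ℝ ∞ φ → HasCompactSupport φ → tsupport φ ⊆ Ioo (-1) 1 →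
    ∫ t in Ioo (-1 : ℝ) 1, u t * deriv φ t = -∫ t in Ioo (-1 : ℝ) 1, v t * φ t

/-- An element of the Sobolev space `H²((-1, 1))`, given by its representative `toFun` that is
continuous up to the end points (so that it can be evaluated at every point of `[-1, 1]`),
together with its weak derivatives of orders one and two, which are square integrable.
Values of `toFun` outside `[-1, 1]` play no role. -/
structure SobolevH2 where
  toFun : ℝ → ℝ
  d1 : ℝ → ℝ
  d2 : ℝ → ℝ
  continuousOn_toFun : ContinuousOn toFun (Icc (-1) 1)
  memLp_d1 : MemLp d1 2 (volume.restrict (Ioo (-1 : ℝ) 1))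
  memLp_d2 : MemLp d2 2 (volume.restrict (Ioo (-1 : ℝ) 1))
  hasWeakDeriv_d1 : HasWeakDeriv toFun d1
  hasWeakDeriv_d2 : HasWeakDeriv d1 d2

/-- The roughness penalty `∫ (u'')²` over `(-1, 1)`. -/
def SobolevH2.roughness (u : SobolevH2) : ℝ :=
  ∫ t in Ioo (-1 : ℝ) 1, (u.d2 t) ^ 2

/-! ### Mapping points -/

/-- First Chebyshev points (encoder points) `cos ((2k - 1)π / (2K))`, `k = 1, …, K`;
the index of `Fin K` starts at `0`. -/
def encPoint (K : ℕ) (k : Fin K) : ℝ :=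
  cos ((2 * (k : ℝ) + 1) * π / (2 * K))

/-- Second Chebyshev points (decoder points) `cos ((n - 1)π / (N - 1))`, `n = 1, …, N`;
the index of `Fin N` starts at `0`. -/
def decPoint (N : ℕ) (n : Fin N) : ℝ :=
  cos ((n : ℝ) * π / ((N : ℝ) - 1))

/-- The decoder points, in their (decreasing) order, preceded by the end point `1` and followed by
the end point `-1` of the interval. -/
def decPointWithEnds (N n : ℕ) : ℝ :=
  if n = 0 then 1 else if h : n - 1 < N then decPoint N ⟨n - 1, h⟩ else -1

/-- Largest distance of consecutive decoder points, the end points of the interval included. -/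
def maxGap (N : ℕ) : ℝ :=
  ⨆ n : Fin (N + 1), |decPointWithEnds N (n + 1) - decPointWithEnds N n|

/-- Smallest distance of consecutive decoder points. -/
def minGap (N : ℕ) : ℝ :=
  ⨅ n : Fin (N - 1), |decPointWithEnds N (n + 2) - decPointWithEnds N (n + 1)|

/-! ### Random stragglers and the recovery loss -/

/-- Probability that `F` is exactly the set of non-stragglers, when each of the `N` servers is a
straggler with probability `p`, independently of the others. -/
def survivorWeight (p : ℝ) {N : ℕ} (F : Finset (Fin N)) : ℝ :=
  (1 - p) ^ F.card * p ^ (N - F.card)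

/-- Expectation of a quantity that depends on the random set of non-stragglers. -/
def expect (p : ℝ) {N : ℕ} (X : Finset (Fin N) → ℝ) : ℝ :=
  ∑ F : Finset (Fin N), survivorWeight p F * X F

open Classical in
/-- Probability of an event that depends on the random set of non-stragglers. -/
def prob (p : ℝ) {N : ℕ} (E : Finset (Fin N) → Prop) : ℝ :=
  ∑ F : Finset (Fin N) with E F, survivorWeight p F

/-- Approximation error `(1/K) ∑ₖ (u(αₖ) - f(xₖ))²` of the estimates `u(αₖ)` of `f(xₖ)`. -/
def recoveryLoss {K : ℕ} (f : ℝ → ℝ) (x : Fin K → ℝ) (u : ℝ → ℝ) : ℝ :=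
  1 / (K : ℝ) * ∑ k, (u (encPoint K k) - f (x k)) ^ 2

/-! ### Learning theoretic coded computing (LeTCC) -/

/-- The regularised least squares objective for the data `(nodes i, y i)`, `i ∈ s`. -/
def splineObjective {n : ℕ} (s : Finset (Fin n)) (nodes y : Fin n → ℝ) (lam : ℝ)
    (u : SobolevH2) : ℝ :=
  1 / (s.card : ℝ) * ∑ i ∈ s, (u.toFun (nodes i) - y i) ^ 2 + lam * u.roughness

/-- `u` is the (second order) smoothing spline of the data `(nodes i, y i)`, `i ∈ s`: it minimises
the objective over `H²`, and it has the least roughness among all minimisers. The second clause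
is automatic for `lam > 0`; for `lam = 0` it selects the natural interpolating spline among all
interpolants. -/
def IsSmoothingSpline {n : ℕ} (s : Finset (Fin n)) (nodes y : Fin n → ℝ) (lam : ℝ)
    (u : SobolevH2) : Prop :=
  (∀ v : SobolevH2, splineObjective s nodes y lam u ≤ splineObjective s nodes y lam v) ∧
  ∀ v : SobolevH2, splineObjective s nodes y lam v = splineObjective s nodes y lam u →
    u.roughness ≤ v.roughness

/-- `enc` and `dec` are an encoder and a decoder of LeTCC for `f` and the data points `x`, with
`N` servers and Chebyshev points. `dec F` is the decoder function used when `F` is the set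
of non-stragglers. If fewer than two servers respond, the spline problem does not determine
a decoder function; the master node may then return any estimates bounded by `M`. -/
structure IsLeTCC {K N : ℕ} (f : ℝ → ℝ) (x : Fin K → ℝ) (lamEnc lamDec M : ℝ)
    (enc : SobolevH2) (dec : Finset (Fin N) → SobolevH2) : Prop where
  encoder : IsSmoothingSpline Finset.univ (encPoint K) x lamEnc enc
  decoder : ∀ F : Finset (Fin N), 2 ≤ F.card →
    IsSmoothingSpline F (decPoint N) (fun v => f (enc.toFun (decPoint N v))) lamDec (dec F)
  fallback : ∀ F : Finset (Fin N), F.card < 2 → ∀ k, |(dec F).toFun (encPoint K k)| ≤ M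

/-! ### Berrut approximated coded computing (BACC) -/

/-- The sign of node `i` in Berrut's interpolant on the nodes indexed by `s`; the signs alternate
along `s`. -/
def berrutSign {n : ℕ} (s : Finset (Fin n)) (i : Fin n) : ℝ :=
  (-1) ^ (s.filter (· < i)).card

open Classical in
/-- Berrut's rational interpolant of the data `(nodes i, y i)`, `i ∈ s`, with its (removable)
singularities at the nodes filled in. -/
def berrut {n : ℕ} (s : Finset (Fin n)) (nodes y : Fin n → ℝ) (z : ℝ) : ℝ :=
  if h : ∃ i ∈ s, nodes i = z then y h.choose
  else ∑ i ∈ s, (berrutSign s i / (z - nodes i)) /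
    (∑ j ∈ s, berrutSign s j / (z - nodes j)) * y i

/-- The encoder function of BACC. -/
def baccEnc {K : ℕ} (x : Fin K → ℝ) : ℝ → ℝ :=
  berrut Finset.univ (encPoint K) x

/-- The decoder function of BACC with `N` servers, when `F` is the set of non-stragglers. -/
def baccDec {K N : ℕ} (f : ℝ → ℝ) (x : Fin K → ℝ) (F : Finset (Fin N)) : ℝ → ℝ :=
  berrut F (decPoint N) (fun v => f (baccEnc x (decPoint N v)))

/-! ### Rates -/

/-- `log_{1/p}(N)³ / N³`. -/
def leTCCRate (p : ℝ) (N : ℕ) : ℝ := (logb (1 / p) N) ^ 3 / (N : ℝ) ^ 3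

/-- `log_{1/p}(N)⁴ / N²`. -/
def baccRate (p : ℝ) (N : ℕ) : ℝ := (logb (1 / p) N) ^ 4 / (N : ℝ) ^ 2

end CodedComputing

end

namespace CodedComputing

/-! ### Random stragglers -/

/-! Both schemes are analysed on one good event: the set `F` of non-stragglers meets every window of
R = ⌈7 log_{1/p} N⌉ consecutive indices (`NoLongGap`). A union bound makes its failure probability
at most N p^R ≤ N^(-6) (`prob_not_noLongGap_le`). Off the good event a crude bound valid for every
`F` suffices: O(1) plus the encoder term for LeTCC, O(N⁴) for BACC. On it, each encoder point, whose
angle stays away from 0 and π, has surviving decoder points on both sides at distance O(log N / N)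
(`NoLongGap.exists_near`).

LeTCC. Let g = f ∘ u_enc. It lies in H², with roughness bounded uniformly in λ_enc
(`exists_encoder_bounds`, `SobolevH2.roughness_comp_le`), and it interpolates the decoder's data.
Minimality therefore makes the decoder function no rougher than the bound for g, and makes its
residuals O(N^(-2)) when λ_dec ≤ N^(-6). By Cauchy-Schwarz the derivative of (decoder - g) is Hölder
of exponent 1/2. Hence between two surviving points at distance h the squared difference is O(h³ +
N^(-4)) (`SobolevH2.sq_sub_le_between`), and h = O(log N / N) gives the rate. What remains, g(α_k) -
f(x_k), is the encoder term; the Lipschitz condition bounds its mean square by a multiple of λ_enc.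

BACC. With g = f ∘ u_enc again, the error at z is a quotient of alternating sums: the divided
differences g[z, t_i] over the reciprocals 1/(z - t_i). Both are handled by the Leibniz criterion.
Divided differences are bounded and Lipschitz in t_i, hence differences of monotone sequences, so
the numerator is O(1) however many nodes there are (`abs_altSum_le`). In the denominator the nodes
above and below z contribute with the same sign, and one side alone gives 1/a - 1/(a + d), with a
bounding the distance from z to some node on that side and d the local spacing. Here a = O(R/N) and
d is at least of order 1/N, so the denominator is at least of order N/R². The error is O(R²/N), and
its square is the rate.

Spacing. The largest gap is of order 1/N because the gaps sum to 2; the smallest is of order N^(-2),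
since the cosine is flat at the end points. -/

theorem survivorWeight_nonneg {p : ℝ} (hp0 : 0 < p) (hp1 : p < 1) {N : ℕ} (F : Finset (Fin N)) :
    0 ≤ survivorWeight p F := by
  have : 0 ≤ 1 - p := by linarith
  unfold survivorWeight
  positivity

/-- The event F ⊆ W says exactly that the N - |W| servers outside W straggle; the binomial theorem
sums out the servers in W. -/
theorem sum_survivorWeight_powerset (p : ℝ) {N : ℕ} (W : Finset (Fin N)) :
    ∑ F ∈ W.powerset, survivorWeight p F = p ^ (N - W.card) := by
  have h : ∀ F ∈ W.powerset, survivorWeight p F =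
      (1 - p) ^ F.card * p ^ (W.card - F.card) * p ^ (N - W.card) := by
    intro F hF
    have h1 := Finset.card_le_card (Finset.mem_powerset.1 hF)
    have h2 : W.card ≤ N := by simpa using Finset.card_le_univ W
    rw [survivorWeight, mul_assoc, ← pow_add]
    congr 2
    omega
  rw [Finset.sum_congr rfl h, ← Finset.sum_mul, Finset.sum_pow_mul_eq_add_pow]
  simp

theorem sum_survivorWeight (p : ℝ) (N : ℕ) : ∑ F : Finset (Fin N), survivorWeight p F = 1 := by
  simpa using sum_survivorWeight_powerset p (Finset.univ : Finset (Fin N))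

theorem sum_biUnion_le_sum {ι κ : Type*} [DecidableEq ι] [DecidableEq κ] {g : κ → ℝ}
    (hg : ∀ i, 0 ≤ g i) (s : Finset ι) (t : ι → Finset κ) :
    ∑ i ∈ s.biUnion t, g i ≤ ∑ a ∈ s, ∑ i ∈ t a, g i := by
  induction s using Finset.induction_on with
  | empty => simp
  | insert a s ha ih =>
    rw [Finset.biUnion_insert, Finset.sum_insert ha]
    have := Finset.sum_union_inter (s₁ := t a) (s₂ := s.biUnion t) (f := g)
    have h0 : 0 ≤ ∑ i ∈ t a ∩ s.biUnion t, g i := Finset.sum_nonneg fun i _ => hg i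
    linarith

/-- `F` meets every window of `R` consecutive indices. -/
def NoLongGap {N : ℕ} (R : ℕ) (F : Finset (Fin N)) : Prop :=
  ∀ m : ℕ, m + R ≤ N → ∃ v ∈ F, m ≤ (v : ℕ) ∧ (v : ℕ) < m + R

open Classical in
-- Union bound: there are at most N windows, and all R servers of a given window straggle with
-- probability p^R.
theorem prob_not_noLongGap_le {p : ℝ} (hp0 : 0 < p) (hp1 : p < 1) (N : ℕ) {R : ℕ} (hR : 1 ≤ R) :
    prob p (fun F : Finset (Fin N) => ¬ NoLongGap R F) ≤ N * p ^ R := by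
  -- `W m` is the complement of the window starting at m, so missing that window means F ⊆ `W m`.
  set W : ℕ → Finset (Fin N) := fun m => Finset.univ.filter fun v => ¬ (m ≤ (v : ℕ) ∧ (v : ℕ) < m + R)
  have hW : ∀ m, m + R ≤ N → N - (W m).card = R := by
    intro m hm
    have h1 : (Finset.univ.filter fun v : Fin N => (m ≤ (v : ℕ) ∧ (v : ℕ) < m + R)).card = R := by
      have : (Finset.univ.filter fun v : Fin N => (m ≤ (v : ℕ) ∧ (v : ℕ) < m + R)).map
          Fin.valEmbedding = Finset.Ico m (m + R) := by
        ext a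
        simp only [Finset.mem_map, Finset.mem_filter, Finset.mem_univ, true_and, Finset.mem_Ico,
          Fin.valEmbedding_apply]
        constructor
        · rintro ⟨v, hv, rfl⟩
          exact hv
        · intro h
          exact ⟨⟨a, by omega⟩, h, rfl⟩
      rw [← Finset.card_map, this]
      simp
    have h2 := Finset.card_filter_add_card_filter_not (s := (Finset.univ : Finset (Fin N)))
      (fun v : Fin N => (m ≤ (v : ℕ) ∧ (v : ℕ) < m + R))
    simp only [Finset.card_univ, Fintype.card_fin] at h2
    change N - (Finset.univ.filter fun v : Fin N => ¬ (m ≤ (v : ℕ) ∧ (v : ℕ) < m + R)).card = R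
    omega
  calc prob p (fun F : Finset (Fin N) => ¬ NoLongGap R F)
      ≤ ∑ F ∈ ((Finset.range N).filter fun m => m + R ≤ N).biUnion fun m => (W m).powerset,
          survivorWeight p F := by
        refine Finset.sum_le_sum_of_subset_of_nonneg ?_
          fun F _ _ => survivorWeight_nonneg hp0 hp1 F
        intro F hF
        simp only [Finset.mem_filter, Finset.mem_univ, true_and, NoLongGap, not_forall] at hF
        obtain ⟨m, hm, hF⟩ := hF
        simp only [Finset.mem_biUnion, Finset.mem_filter, Finset.mem_range, Finset.mem_powerset]
        refine ⟨m, ⟨by omega, hm⟩, fun v hv => ?_⟩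
        simp only [W, Finset.mem_filter, Finset.mem_univ, true_and]
        exact fun h => hF ⟨v, hv, h⟩
    _ ≤ ∑ m ∈ (Finset.range N).filter (fun m => m + R ≤ N), ∑ F ∈ (W m).powerset,
          survivorWeight p F :=
        sum_biUnion_le_sum (fun F => survivorWeight_nonneg hp0 hp1 F) _ _
    _ = ∑ m ∈ (Finset.range N).filter (fun m => m + R ≤ N), p ^ R := by
        refine Finset.sum_congr rfl fun m hm => ?_
        rw [sum_survivorWeight_powerset, hW m (Finset.mem_filter.1 hm).2]
    _ ≤ N * p ^ R := by
        rw [Finset.sum_const, nsmul_eq_mul]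
        gcongr
        simpa using Finset.card_filter_le (Finset.range N) (fun m => m + R ≤ N)

open Classical in
theorem prob_add_prob_not (p : ℝ) {N : ℕ} (E : Finset (Fin N) → Prop) :
    prob p E + prob p (fun F => ¬ E F) = 1 := by
  rw [← sum_survivorWeight p N, ← Finset.sum_filter_add_sum_filter_not _ E]
  unfold prob
  congr!

open Classical in
theorem prob_mono {p : ℝ} (hp0 : 0 < p) (hp1 : p < 1) {N : ℕ} {E E' : Finset (Fin N) → Prop}
    (h : ∀ F, E F → E' F) : prob p E ≤ prob p E' := by
  refine Finset.sum_le_sum_of_subset_of_nonneg ?_ fun F _ _ => survivorWeight_nonneg hp0 hp1 F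
  intro F hF
  simp only [Finset.mem_filter, Finset.mem_univ, true_and] at hF ⊢
  exact h F hF

open Classical in
-- Combines a sharp bound on a likely event with a crude bound on all outcomes: X ≤ a + b · 1_{¬E}.
theorem expect_le_of_forall {p : ℝ} (hp0 : 0 < p) (hp1 : p < 1) {N : ℕ}
    {X : Finset (Fin N) → ℝ} {E : Finset (Fin N) → Prop} {a b : ℝ}
    (hgood : ∀ F, E F → X F ≤ a) (hall : ∀ F, X F ≤ a + b) :
    expect p X ≤ a + b * prob p (fun F => ¬ E F) := by
  calc expect p X
      ≤ ∑ F : Finset (Fin N), (survivorWeight p F * a +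
          b * if ¬ E F then survivorWeight p F else 0) := by
        refine Finset.sum_le_sum fun F _ => ?_
        have h0 := survivorWeight_nonneg hp0 hp1 F
        by_cases h : E F
        · simpa [h] using mul_le_mul_of_nonneg_left (hgood F h) h0
        · have := mul_le_mul_of_nonneg_left (hall F) h0
          simp only [h, not_false_eq_true, if_true]
          linarith
    _ = a + b * prob p (fun F => ¬ E F) := by
        rw [Finset.sum_add_distrib, ← Finset.sum_mul, sum_survivorWeight, one_mul,
          ← Finset.mul_sum, prob, Finset.sum_filter]
        congr!

/-! ### Rates -/

/-- Window length `⌈7 log_{1/p} N⌉`. -/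
noncomputable def windowLength (p : ℝ) (N : ℕ) : ℕ := ⌈7 * logb (1 / p) N⌉₊

theorem tendsto_logb_natCast {p : ℝ} (hp0 : 0 < p) (hp1 : p < 1) :
    Tendsto (fun N : ℕ => logb (1 / p) N) atTop atTop :=
  (tendsto_logb_atTop ((one_lt_div hp0).2 hp1)).comp tendsto_natCast_atTop_atTop

theorem eventually_logb_le {p c : ℝ} (hc : 0 < c) (hp0 : 0 < p) (hp1 : p < 1) :
    ∀ᶠ N : ℕ in atTop, logb (1 / p) N ≤ c * N := by
  have h1 : 0 < log (1 / p) := log_pos ((one_lt_div hp0).2 hp1)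
  have h := (isLittleO_log_id_atTop.comp_tendsto (tendsto_natCast_atTop_atTop (R := ℝ))).def
    (mul_pos hc h1)
  filter_upwards [h] with N hN
  rw [logb, div_le_iff₀ h1]
  simp only [Function.comp, id, norm_eq_abs, Nat.abs_cast] at hN
  calc log N ≤ |log N| := le_abs_self _
    _ ≤ _ := hN
    _ = _ := by ring

/-- The factor 7 in the window length leaves N · N^(-7) = N^(-6), small enough to turn the crude
O(N⁴) loss of BACC into O(N^(-2)). -/
theorem eventually_windowLength {p : ℝ} (hp0 : 0 < p) (hp1 : p < 1) {c : ℝ} (hc : 0 < c) :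
    ∀ᶠ N : ℕ in atTop, 2 ≤ N ∧ 1 ≤ logb (1 / p) N ∧ 1 ≤ windowLength p N ∧
      (windowLength p N : ℝ) ≤ 8 * logb (1 / p) N ∧
      (windowLength p N : ℝ) + 1 ≤ c * ((N : ℝ) - 1) ∧
      (N : ℝ) * p ^ windowLength p N ≤ ((N : ℝ) ^ 6)⁻¹ := by
  -- Rounding up costs at most 1 ≤ log N (base 1/p), hence R ≤ 8 log N. Then R + 1 ≤ 9 log N ≤ 9
  -- (c/18) N = cN/2 ≤ c(N - 1), which explains c/18.
  filter_upwards [eventually_ge_atTop 2, (tendsto_logb_natCast hp0 hp1).eventually_ge_atTop 1,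
    eventually_logb_le (c := c / 18) (by positivity) hp0 hp1] with N hN hL hc'
  have hN' : (2 : ℝ) ≤ N := by exact_mod_cast hN
  have hR : (windowLength p N : ℝ) ≤ 8 * logb (1 / p) N := by
    have := Nat.ceil_lt_add_one (a := 7 * logb (1 / p) N) (by linarith)
    rw [windowLength]
    linarith
  have hR' : 7 * logb (1 / p) N ≤ windowLength p N := Nat.le_ceil _
  refine ⟨hN, hL, ?_, hR, ?_, ?_⟩
  · have : (1 : ℝ) ≤ windowLength p N := by linarith
    exact_mod_cast this
  · nlinarith
  · have h1 : p ^ windowLength p N ≤ ((N : ℝ) ^ 7)⁻¹ := by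
      rw [← rpow_natCast p, ← rpow_natCast (N : ℝ) 7, ← rpow_neg (by positivity)]
      calc p ^ (windowLength p N : ℝ) ≤ p ^ (7 * logb (1 / p) N) :=
            rpow_le_rpow_of_exponent_ge hp0 hp1.le hR'
        _ = (p ^ logb p N) ^ (-(7 : ℕ) : ℝ) := by
            rw [← rpow_mul hp0.le]
            congr 1
            rw [one_div, logb_inv_base]
            push_cast
            ring
        _ = (N : ℝ) ^ (-(7 : ℕ) : ℝ) := by
            rw [rpow_logb hp0 hp1.ne (by linarith)]
    calc (N : ℝ) * p ^ windowLength p N ≤ N * ((N : ℝ) ^ 7)⁻¹ := by gcongr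
      _ = ((N : ℝ) ^ 6)⁻¹ := by field_simp

theorem prob_not_noLongGap_windowLength_le {p : ℝ} (hp0 : 0 < p) (hp1 : p < 1) :
    ∀ᶠ N : ℕ in atTop,
      prob p (fun F : Finset (Fin N) => ¬ NoLongGap (windowLength p N) F) ≤ ((N : ℝ) ^ 6)⁻¹ := by
  filter_upwards [eventually_windowLength hp0 hp1 one_pos] with N hN
  exact (prob_not_noLongGap_le hp0 hp1 N hN.2.2.1).trans hN.2.2.2.2.2

theorem prob_noLongGap_windowLength_ge {p : ℝ} (hp0 : 0 < p) (hp1 : p < 1) {δ : ℝ} (hδ : 0 < δ) :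
    ∀ᶠ N : ℕ in atTop,
      1 - δ ≤ prob p (fun F : Finset (Fin N) => NoLongGap (windowLength p N) F) := by
  have h0 : Tendsto (fun N : ℕ => ((N : ℝ) ^ 6)⁻¹) atTop (𝓝 0) :=
    ((tendsto_pow_atTop (by norm_num)).comp tendsto_natCast_atTop_atTop).inv_tendsto_atTop
  filter_upwards [prob_not_noLongGap_windowLength_le hp0 hp1, h0.eventually_le_const hδ] with N h1 h2
  have := prob_add_prob_not p (fun F : Finset (Fin N) => NoLongGap (windowLength p N) F)
  linarith

/-! ### Chebyshev points -/

/-- Product formula and Jordan's inequality. The midpoint (a + b)/2 is at least (b - a)/2 away from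
both 0 and π, so its sine dominates sin((b - a)/2). -/
theorem cos_sub_cos_ge {a b : ℝ} (ha : 0 ≤ a) (hab : a ≤ b) (hb : b ≤ π) :
    2 * ((b - a) / π) ^ 2 ≤ cos a - cos b := by
  have hπ := pi_pos
  have h1 : cos a - cos b = 2 * sin ((a + b) / 2) * sin ((b - a) / 2) := by
    rw [cos_sub_cos, show (a - b) / 2 = -((b - a) / 2) by ring, sin_neg]
    ring
  have h2 : (b - a) / π ≤ sin ((b - a) / 2) := by
    have := mul_le_sin (x := (b - a) / 2) (by linarith) (by linarith)
    calc (b - a) / π = 2 / π * ((b - a) / 2) := by ring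
      _ ≤ _ := this
  have h3 : sin ((b - a) / 2) ≤ sin ((a + b) / 2) := by
    rcases le_total ((a + b) / 2) (π / 2) with h | h
    · exact sin_le_sin_of_le_of_le_pi_div_two (by linarith) h (by linarith)
    · rw [← sin_pi_sub ((a + b) / 2)]
      exact sin_le_sin_of_le_of_le_pi_div_two (by linarith) (by linarith) (by linarith)
  have h0 : 0 ≤ (b - a) / π := div_nonneg (by linarith) hπ.le
  rw [h1]
  nlinarith

/-- Away from the end points the sine of the midpoint is at least sin θ, so the bound is linear in b
- a. This raises the available node spacing from order N^(-2) to order N^(-1). -/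
theorem cos_sub_cos_ge_of_mem {a b θ : ℝ} (hθ : 0 ≤ θ) (ha : θ ≤ a) (hab : a ≤ b)
    (hb : b ≤ π - θ) : 2 * sin θ * ((b - a) / π) ≤ cos a - cos b := by
  have hπ := pi_pos
  have h1 : cos a - cos b = 2 * sin ((a + b) / 2) * sin ((b - a) / 2) := by
    rw [cos_sub_cos, show (a - b) / 2 = -((b - a) / 2) by ring, sin_neg]
    ring
  have h2 : (b - a) / π ≤ sin ((b - a) / 2) := by
    have := mul_le_sin (x := (b - a) / 2) (by linarith) (by linarith)
    calc (b - a) / π = 2 / π * ((b - a) / 2) := by ring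
      _ ≤ _ := this
  have h3 : sin θ ≤ sin ((a + b) / 2) := by
    rcases le_total ((a + b) / 2) (π / 2) with h | h
    · exact sin_le_sin_of_le_of_le_pi_div_two (by linarith) h (by linarith)
    · rw [← sin_pi_sub ((a + b) / 2)]
      exact sin_le_sin_of_le_of_le_pi_div_two (by linarith) (by linarith) (by linarith)
  have h0 : 0 ≤ (b - a) / π := div_nonneg (by linarith) hπ.le
  have h4 : 0 ≤ sin θ := sin_nonneg_of_nonneg_of_le_pi hθ (by linarith)
  rw [h1]
  exact mul_le_mul (by linarith) h2 h0 (by linarith)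

theorem abs_cos_sub_cos_le (a b : ℝ) : |cos a - cos b| ≤ |a - b| := by
  have h := Convex.norm_image_sub_le_of_norm_deriv_le (f := cos) (C := 1) (s := univ)
    (x := b) (y := a) (fun x _ => differentiableAt_cos)
    (fun x _ => by simpa [Real.deriv_cos] using abs_sin_le_one x) convex_univ trivial trivial
  simpa using h

/-- The angle of a decoder point. -/
noncomputable def decAngle (N : ℕ) (n : ℕ) : ℝ := n * π / ((N : ℝ) - 1)

theorem decPoint_eq_cos {N : ℕ} (n : Fin N) : decPoint N n = cos (decAngle N n) := rfl

theorem decAngle_nonneg {N : ℕ} (hN : 2 ≤ N) (n : ℕ) : 0 ≤ decAngle N n := by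
  have hN' : (2 : ℝ) ≤ N := by exact_mod_cast hN
  exact div_nonneg (by positivity) (by linarith)

theorem decAngle_le_pi {N : ℕ} (hN : 2 ≤ N) {n : ℕ} (hn : n < N) : decAngle N n ≤ π := by
  have hN' : (2 : ℝ) ≤ N := by exact_mod_cast hN
  have hn' : (n : ℝ) + 1 ≤ N := by exact_mod_cast hn
  rw [decAngle, div_le_iff₀ (by linarith), mul_comm]
  exact mul_le_mul_of_nonneg_left (by linarith) pi_pos.le

theorem decAngle_sub {N : ℕ} (m n : ℕ) :
    decAngle N n - decAngle N m = ((n : ℝ) - m) * (π / ((N : ℝ) - 1)) := by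
  unfold decAngle
  ring

theorem decAngle_add_le {N : ℕ} (hN : 2 ≤ N) {m n : ℕ} (h : m < n) :
    decAngle N m + π / ((N : ℝ) - 1) ≤ decAngle N n := by
  have hN' : (2 : ℝ) ≤ N := by exact_mod_cast hN
  have h' : (m : ℝ) + 1 ≤ n := by exact_mod_cast h
  have h1 : 0 ≤ π / ((N : ℝ) - 1) := div_nonneg pi_pos.le (by linarith)
  have := decAngle_sub (N := N) m n
  nlinarith

theorem decPoint_sub_ge {N : ℕ} (hN : 2 ≤ N) {m n : Fin N} (h : m < n) :
    2 / ((N : ℝ) - 1) ^ 2 ≤ decPoint N m - decPoint N n := by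
  have hN' : (2 : ℝ) ≤ N := by exact_mod_cast hN
  have h1 : 0 < π / ((N : ℝ) - 1) := div_pos pi_pos (by linarith)
  have h2 := decAngle_add_le hN (m := m) (n := n) h
  have h3 := cos_sub_cos_ge (decAngle_nonneg hN m) (by linarith) (decAngle_le_pi hN n.2)
  refine le_trans ?_ h3
  have h4 : 1 / ((N : ℝ) - 1) ≤ (decAngle N n - decAngle N m) / π := by
    rw [le_div_iff₀ pi_pos, div_mul_eq_mul_div, one_mul]
    linarith
  calc 2 / ((N : ℝ) - 1) ^ 2 = 2 * (1 / ((N : ℝ) - 1)) ^ 2 := by rw [div_pow, one_pow, mul_one_div]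
    _ ≤ _ := by
      have : 0 ≤ 1 / ((N : ℝ) - 1) := div_nonneg zero_le_one (by linarith)
      gcongr

theorem decPoint_strictAnti {N : ℕ} (hN : 2 ≤ N) : StrictAnti (decPoint N) := by
  intro m n h
  have hN' : (2 : ℝ) ≤ N := by exact_mod_cast hN
  have h1 := decPoint_sub_ge hN h
  have : 0 < 2 / ((N : ℝ) - 1) ^ 2 := div_pos two_pos (pow_pos (by linarith) 2)
  linarith

theorem decPoint_mem_Icc {N : ℕ} (n : Fin N) : decPoint N n ∈ Icc (-1 : ℝ) 1 :=
  ⟨neg_one_le_cos _, cos_le_one _⟩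

theorem encPoint_mem_Icc {K : ℕ} (k : Fin K) : encPoint K k ∈ Icc (-1 : ℝ) 1 :=
  ⟨neg_one_le_cos _, cos_le_one _⟩

/-- The angle of an encoder point. -/
noncomputable def encAngle (K : ℕ) (k : ℕ) : ℝ := (2 * (k : ℝ) + 1) * π / (2 * K)

theorem encPoint_eq_cos {K : ℕ} (k : Fin K) : encPoint K k = cos (encAngle K k) := rfl

theorem encAngle_mem {K : ℕ} (k : Fin K) :
    encAngle K k ∈ Icc (π / (2 * K)) (π - π / (2 * K)) := by
  have hK : 0 < (K : ℝ) := by exact_mod_cast k.pos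
  have hk : ((k : ℕ) : ℝ) + 1 ≤ K := by exact_mod_cast k.2
  have hk0 : (0 : ℝ) ≤ ((k : ℕ) : ℝ) := Nat.cast_nonneg _
  have hπ := pi_pos
  constructor
  · rw [encAngle]
    gcongr
    nlinarith
  · rw [encAngle, le_sub_iff_add_le, ← add_div, div_le_iff₀ (by positivity)]
    nlinarith

theorem encPoint_strictAnti (K : ℕ) : StrictAnti (encPoint K) := by
  intro m n h
  have hK : 0 < (K : ℝ) := by exact_mod_cast m.pos
  have hπ := pi_pos
  have h0 : 0 < π / (2 * K) := by positivity
  have h1 : encAngle K m < encAngle K n := by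
    have : ((m : ℕ) : ℝ) < ((n : ℕ) : ℝ) := by exact_mod_cast h
    unfold encAngle
    gcongr
  exact cos_lt_cos_of_nonneg_of_le_pi (h0.le.trans (encAngle_mem m).1)
    ((encAngle_mem n).2.trans (by linarith)) h1

/-- A set of indices without long gaps has decoder points close to `cos θ` on both sides. -/
theorem NoLongGap.exists_near {N R : ℕ} (hN : 2 ≤ N) {F : Finset (Fin N)} (hF : NoLongGap R F)
    {θ₀ θ : ℝ} (hθ : θ ∈ Icc θ₀ (π - θ₀)) (hR : ((R : ℝ) + 1) * (π / ((N : ℝ) - 1)) ≤ θ₀) :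
    (∃ v ∈ F, θ < decAngle N v ∧ decAngle N v ≤ θ + R * (π / ((N : ℝ) - 1))) ∧
    (∃ v ∈ F, θ - R * (π / ((N : ℝ) - 1)) ≤ decAngle N v ∧ decAngle N v ≤ θ) := by
  have hN' : (2 : ℝ) ≤ N := by exact_mod_cast hN
  set δ := π / ((N : ℝ) - 1) with hδ
  have hδ0 : 0 < δ := div_pos pi_pos (by linarith)
  have hδπ : ((N : ℝ) - 1) * δ = π := by
    rw [hδ]
    field_simp [show (N : ℝ) - 1 ≠ 0 by linarith]
  have hang : ∀ n : ℕ, decAngle N n = n * δ := fun n => by rw [decAngle, mul_div_assoc]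
  have hR0 : (0 : ℝ) ≤ R := Nat.cast_nonneg _
  have hθ0 : 0 ≤ θ := by nlinarith [hθ.1]
  -- The last multiple of the angular step not exceeding θ has index s. The windows used are s+1, …,
  -- s+R and s+1-R, …, s; the margin of R + 1 steps on either side keeps both within the indices.
  set s := ⌊θ / δ⌋₊ with hs
  have hs1 : s * δ ≤ θ := by
    rw [← le_div_iff₀ hδ0]
    exact Nat.floor_le (by positivity)
  have hs2 : θ < (s + 1) * δ := by
    rw [← div_lt_iff₀ hδ0]
    exact Nat.lt_floor_add_one _
  simp only [hang]
  constructor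
  · have hm : s + 1 + R ≤ N := by
      have h1 : ((s : ℝ) + (R + 1)) * δ ≤ ((N : ℝ) - 1) * δ := by
        rw [hδπ]
        nlinarith [hθ.2]
      have h2 := le_of_mul_le_mul_right h1 hδ0
      have h3 : ((s + 1 + R : ℕ) : ℝ) ≤ N := by
        push_cast
        linarith
      exact_mod_cast h3
    obtain ⟨v, hv, h1, h2⟩ := hF (s + 1) hm
    have h1' : (s : ℝ) + 1 ≤ (v : ℕ) := by exact_mod_cast h1
    have h2' : ((v : ℕ) : ℝ) ≤ s + R := by
      have : (v : ℕ) ≤ s + R := by omega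
      exact_mod_cast this
    exact ⟨v, hv, by nlinarith, by nlinarith⟩
  · have hRs : R ≤ s := by
      have h1 : (R : ℝ) * δ < (s + 1) * δ := by
        nlinarith [hθ.1]
      have h2 := lt_of_mul_lt_mul_right h1 hδ0.le
      have h3 : R < s + 1 := by exact_mod_cast h2
      omega
    have hsN : s + 1 ≤ N := by
      have h1 : (s : ℝ) * δ < (N : ℝ) * δ := by
        nlinarith [hθ.2, hθ.1]
      have h2 := lt_of_mul_lt_mul_right h1 hδ0.le
      exact_mod_cast h2
    obtain ⟨v, hv, h1, h2⟩ := hF (s + 1 - R) (by omega)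
    have h1' : (s : ℝ) + 1 - R ≤ (v : ℕ) := by
      have : s + 1 ≤ (v : ℕ) + R := by omega
      have : (s : ℝ) + 1 ≤ (v : ℕ) + R := by exact_mod_cast this
      linarith
    have h2' : ((v : ℕ) : ℝ) ≤ s := by
      have : (v : ℕ) ≤ s := by omega
      exact_mod_cast this
    exact ⟨v, hv, by nlinarith, by nlinarith⟩

/-! ### The spacing of the decoder points -/

theorem decPointWithEnds_succ {N n : ℕ} (hn : n < N) :
    decPointWithEnds N (n + 1) = cos (decAngle N n) := by
  simp [decPointWithEnds, hn, decPoint, decAngle]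

theorem decAngle_pred {N : ℕ} (hN : 2 ≤ N) : decAngle N (N - 1) = π := by
  have hN' : (2 : ℝ) ≤ N := by exact_mod_cast hN
  rw [decAngle, Nat.cast_sub (by omega), Nat.cast_one, mul_div_assoc, mul_div_cancel₀]
  linarith

theorem abs_decPointWithEnds_sub_le {N : ℕ} (hN : 2 ≤ N) (n : Fin (N + 1)) :
    |decPointWithEnds N (n + 1) - decPointWithEnds N n| ≤ π / ((N : ℝ) - 1) := by
  have hN' : (2 : ℝ) ≤ N := by exact_mod_cast hN
  have h0 : 0 ≤ π / ((N : ℝ) - 1) := div_nonneg pi_pos.le (by linarith)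
  rcases n with ⟨n, hn⟩
  simp only
  -- The outermost decoder points are ±1 themselves, so the gaps to the two adjoined end points
  -- vanish.
  rcases Nat.eq_zero_or_pos n with rfl | hn0
  · rw [decPointWithEnds_succ (by omega)]
    simpa [decPointWithEnds, decAngle] using h0
  · obtain ⟨m, rfl⟩ : ∃ m, n = m + 1 := ⟨n - 1, by omega⟩
    rw [decPointWithEnds_succ (by omega : m < N)]
    by_cases hm : m + 1 < N
    · rw [decPointWithEnds_succ hm]
      refine (abs_cos_sub_cos_le _ _).trans ?_
      rw [decAngle_sub]
      push_cast
      rw [add_sub_cancel_left, one_mul, abs_of_nonneg h0]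
    · obtain rfl : m = N - 1 := by omega
      rw [decAngle_pred hN]
      have : decPointWithEnds N (N - 1 + 1 + 1) = -1 := by
        have h : ¬ (N - 1 + 1 < N) := by omega
        simp [decPointWithEnds, h]
      rw [this]
      simpa using h0

theorem maxGap_le {N : ℕ} (hN : 2 ≤ N) : maxGap N ≤ π / ((N : ℝ) - 1) :=
  ciSup_le (abs_decPointWithEnds_sub_le hN)

/-- The N - 1 gaps between decoder points telescope to cos 0 - cos π = 2, and the largest is at
least their average. -/
theorem le_maxGap {N : ℕ} (hN : 2 ≤ N) : 2 / ((N : ℝ) - 1) ≤ maxGap N := by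
  have hN' : (2 : ℝ) ≤ N := by exact_mod_cast hN
  have hb : BddAbove (range fun n : Fin (N + 1) =>
      |decPointWithEnds N (n + 1) - decPointWithEnds N n|) := (Set.finite_range _).bddAbove
  have h1 : ∀ i < N - 1, decPointWithEnds N (i + 1) - decPointWithEnds N (i + 2) ≤ maxGap N := by
    intro i hi
    refine le_trans ?_ (le_ciSup hb ⟨i + 1, by omega⟩)
    rw [abs_sub_comm]
    exact le_abs_self _
  have h2 := Finset.sum_le_sum (s := Finset.range (N - 1))
    fun i hi => h1 i (Finset.mem_range.1 hi)
  rw [Finset.sum_range_sub' (fun i => decPointWithEnds N (i + 1))] at h2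
  simp only [Finset.sum_const, Finset.card_range, nsmul_eq_mul] at h2
  rw [decPointWithEnds_succ (by omega), decPointWithEnds_succ (by omega), decAngle_pred hN,
    Nat.cast_sub (by omega)] at h2
  simp only [decAngle, CharP.cast_eq_zero, zero_mul, zero_div, cos_zero, cos_pi, Nat.cast_one]
    at h2
  rw [div_le_iff₀ (by linarith)]
  linarith

theorem le_minGap {N : ℕ} (hN : 2 ≤ N) : 2 / ((N : ℝ) - 1) ^ 2 ≤ minGap N := by
  -- A real infimum over an empty index type would be 0.
  have : Nonempty (Fin (N - 1)) := ⟨⟨0, by omega⟩⟩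
  refine le_ciInf fun n => ?_
  rw [decPointWithEnds_succ (n := n + 1) (by omega), decPointWithEnds_succ (by omega), abs_sub_comm]
  exact (decPoint_sub_ge hN (m := ⟨n, by omega⟩) (n := ⟨n + 1, by omega⟩)
    (by simp)).trans (le_abs_self _)

/-- The first gap is 1 - cos(π/(N - 1)), quadratically small. -/
theorem minGap_le {N : ℕ} (hN : 2 ≤ N) : minGap N ≤ (π / ((N : ℝ) - 1)) ^ 2 / 2 := by
  have hb : BddBelow (range fun n : Fin (N - 1) =>
      |decPointWithEnds N (n + 2) - decPointWithEnds N (n + 1)|) := (Set.finite_range _).bddBelow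
  refine (ciInf_le hb ⟨0, by omega⟩).trans ?_
  simp only
  rw [decPointWithEnds_succ (n := 0 + 1) (by omega), decPointWithEnds_succ (by omega),
    abs_sub_comm]
  have h := one_sub_sq_div_two_le_cos (x := π / ((N : ℝ) - 1))
  have h1 : decAngle N (0 + 1) = π / ((N : ℝ) - 1) := by simp [decAngle]
  have h2 : decAngle N 0 = 0 := by simp [decAngle]
  rw [h1, h2, cos_zero, abs_of_nonneg (by linarith [cos_le_one (π / ((N : ℝ) - 1))])]
  linarith

theorem maxGap_div_minGap_isBigO :
    (fun N : ℕ => maxGap N / minGap N) =O[atTop] (fun N : ℕ => (N : ℝ)) := by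
  refine Asymptotics.IsBigO.of_bound (π / 2) ?_
  filter_upwards [eventually_ge_atTop 2] with N hN
  have hN' : (2 : ℝ) ≤ N := by exact_mod_cast hN
  have hN1 : 0 < (N : ℝ) - 1 := by linarith
  have h1 : 0 < 2 / ((N : ℝ) - 1) ^ 2 := by positivity
  have h2 : 0 < 2 / ((N : ℝ) - 1) := by positivity
  have h3 : 0 < minGap N := h1.trans_le (le_minGap hN)
  have h4 : 0 < maxGap N := h2.trans_le (le_maxGap hN)
  rw [norm_of_nonneg (by positivity), norm_of_nonneg (by positivity)]
  calc maxGap N / minGap N ≤ (π / ((N : ℝ) - 1)) / (2 / ((N : ℝ) - 1) ^ 2) :=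
        div_le_div₀ (by positivity) (maxGap_le hN) h1 (le_minGap hN)
    _ = π / 2 * ((N : ℝ) - 1) := by field_simp
    _ ≤ π / 2 * N := by
        gcongr
        linarith

theorem tendsto_maxGap_div_minGap :
    Tendsto (fun N : ℕ => maxGap N / minGap N) atTop atTop := by
  have h0 : Tendsto (fun N : ℕ => 4 / π ^ 2 * ((N : ℝ) + (-1))) atTop atTop :=
    (tendsto_atTop_add_const_right _ _ tendsto_natCast_atTop_atTop).const_mul_atTop (by positivity)
  refine tendsto_atTop_mono' _ ?_ h0
  filter_upwards [eventually_ge_atTop 2] with N hN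
  have hN' : (2 : ℝ) ≤ N := by exact_mod_cast hN
  have hN1 : 0 < (N : ℝ) - 1 := by linarith
  have h1 : 0 < 2 / ((N : ℝ) - 1) ^ 2 := by positivity
  have h3 : 0 < minGap N := h1.trans_le (le_minGap hN)
  have hπ := pi_pos
  calc 4 / π ^ 2 * ((N : ℝ) + (-1)) = 4 / π ^ 2 * ((N : ℝ) - 1) := by ring
    _ = (2 / ((N : ℝ) - 1)) / ((π / ((N : ℝ) - 1)) ^ 2 / 2) := by field_simp; ring
    _ ≤ maxGap N / minGap N :=
        div_le_div₀ ((by positivity : (0 : ℝ) ≤ 2 / ((N : ℝ) - 1)).trans (le_maxGap hN))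
          (le_maxGap hN) h3 (minGap_le hN)

/-! ### Alternating sums -/

/-- The sum of `w` over `s` with the alternating signs of Berrut's interpolant. -/
noncomputable def altSum {n : ℕ} (s : Finset (Fin n)) (w : Fin n → ℝ) : ℝ :=
  ∑ i ∈ s, berrutSign s i * w i

theorem altSum_congr {n : ℕ} {s : Finset (Fin n)} {w w' : Fin n → ℝ} (h : ∀ i ∈ s, w i = w' i) :
    altSum s w = altSum s w' :=
  Finset.sum_congr rfl fun i hi => by rw [h i hi]

theorem altSum_sub {n : ℕ} (s : Finset (Fin n)) (w w' : Fin n → ℝ) :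
    altSum s (fun i => w i - w' i) = altSum s w - altSum s w' := by
  simp only [altSum, mul_sub, Finset.sum_sub_distrib]

theorem altSum_neg {n : ℕ} (s : Finset (Fin n)) (w : Fin n → ℝ) :
    altSum s (fun i => -w i) = -altSum s w := by
  simp only [altSum, mul_neg, Finset.sum_neg_distrib]

/-- All of A precedes each element of B, which multiplies the signs on B by (-1)^|A|. -/
theorem altSum_union {n : ℕ} {A B : Finset (Fin n)} (h : ∀ i ∈ A, ∀ j ∈ B, i < j)
    (w : Fin n → ℝ) : altSum (A ∪ B) w = altSum A w + (-1) ^ A.card * altSum B w := by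
  have hd : Disjoint A B := Finset.disjoint_left.2 fun i hi hj => lt_irrefl _ (h i hi i hj)
  rw [altSum, Finset.sum_union hd, altSum, altSum, Finset.mul_sum]
  congr 1
  · refine Finset.sum_congr rfl fun i hi => ?_
    have : (A ∪ B).filter (· < i) = A.filter (· < i) := by
      ext j
      simp only [Finset.mem_filter, Finset.mem_union]
      exact ⟨fun hj => ⟨hj.1.resolve_right fun hB => lt_asymm hj.2 (h i hi j hB), hj.2⟩,
        fun hj => ⟨Or.inl hj.1, hj.2⟩⟩
    rw [berrutSign, this, berrutSign]
  · refine Finset.sum_congr rfl fun i hi => ?_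
    have : (A ∪ B).filter (· < i) = A ∪ B.filter (· < i) := by
      ext j
      simp only [Finset.mem_filter, Finset.mem_union]
      exact ⟨fun hj => hj.1.imp_right fun hB => ⟨hB, hj.2⟩,
        fun hj => hj.elim (fun hA => ⟨Or.inl hA, h j hA i hi⟩) fun hB => ⟨Or.inr hB.1, hB.2⟩⟩
    rw [berrutSign, this, Finset.card_union_of_disjoint
      (hd.mono_right (Finset.filter_subset _ _)), pow_add, berrutSign, mul_assoc]

theorem altSum_singleton {n : ℕ} (m : Fin n) (w : Fin n → ℝ) : altSum {m} w = w m := by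
  simp [altSum, berrutSign, Finset.filter_singleton]

theorem altSum_insert_min {n : ℕ} {m : Fin n} {B : Finset (Fin n)} (h : ∀ i ∈ B, m < i)
    (w : Fin n → ℝ) : altSum (insert m B) w = w m - altSum B w := by
  rw [Finset.insert_eq, altSum_union (by simpa using h), altSum_singleton]
  simp
  ring

theorem altSum_insert_max {n : ℕ} {m : Fin n} {A : Finset (Fin n)} (h : ∀ i ∈ A, i < m)
    (w : Fin n → ℝ) :
    (-1) ^ ((insert m A).card + 1) * altSum (insert m A) w =
      w m - (-1) ^ (A.card + 1) * altSum A w := by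
  have hm : m ∉ A := fun hA => lt_irrefl _ (h m hA)
  rw [Finset.card_insert_of_notMem hm, Finset.insert_eq, Finset.union_comm,
    altSum_union (by simpa using h), altSum_singleton]
  have : ((-1 : ℝ) ^ A.card) * (-1) ^ A.card = 1 := by
    rw [← mul_pow]
    simp
  rw [pow_succ, pow_succ]
  linear_combination w m * this

/-- Leibniz criterion: removing the smallest index m leaves w m minus a tail, which by induction
lies in [0, w m]. -/
theorem altSum_mem_Icc_of_antitone {n : ℕ} {w : Fin n → ℝ} (B : Finset (Fin n)) {c : ℝ}
    (hw : AntitoneOn w B) (h0 : ∀ i ∈ B, 0 ≤ w i) (hc : 0 ≤ c) (hwc : ∀ i ∈ B, w i ≤ c) :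
    altSum B w ∈ Icc 0 c := by
  induction B using Finset.induction_on_min generalizing c with
  | empty => simpa [altSum] using hc
  | insert m B hm ih =>
    have h1 := ih (hw.mono (by simp)) (fun i hi => h0 i (by simp [hi])) (h0 m (by simp))
      fun i hi => hw (by simp) (by simp [hi]) (hm i hi).le
    rw [altSum_insert_min hm]
    have := hwc m (by simp)
    exact ⟨by linarith [h1.2], by linarith [h1.1]⟩

/-- The Leibniz criterion read from the other end; the factor (-1)^(|A| + 1) gives the last, largest
term the sign +. -/
theorem altSum_mem_Icc_of_monotone {n : ℕ} {w : Fin n → ℝ} (A : Finset (Fin n)) {c : ℝ}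
    (hw : MonotoneOn w A) (h0 : ∀ i ∈ A, 0 ≤ w i) (hc : 0 ≤ c) (hwc : ∀ i ∈ A, w i ≤ c) :
    (-1) ^ (A.card + 1) * altSum A w ∈ Icc 0 c := by
  induction A using Finset.induction_on_max generalizing c with
  | empty => simpa [altSum] using hc
  | insert m A hm ih =>
    have h1 := ih (hw.mono (by simp)) (fun i hi => h0 i (by simp [hi])) (h0 m (by simp))
      fun i hi => hw (by simp [hi]) (by simp) (hm i hi).le
    rw [altSum_insert_max hm]
    have := hwc m (by simp)
    exact ⟨by linarith [h1.2], by linarith [h1.1]⟩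

/-- The terms after the first are at most w(min) - δ, hence so is their alternating sum, which is
subtracted from w(min). -/
theorem le_altSum_of_antitone {n : ℕ} {w : Fin n → ℝ} {B : Finset (Fin n)} (hB : B.Nonempty)
    {δ : ℝ} (hw : AntitoneOn w B) (h0 : ∀ i ∈ B, 0 ≤ w i) (hδ : δ ≤ w (B.min' hB))
    (hgap : ∀ i ∈ B, B.min' hB < i → w i ≤ w (B.min' hB) - δ) : δ ≤ altSum B w := by
  set m := B.min' hB
  have hm : ∀ i ∈ B.erase m, m < i := fun i hi =>
    lt_of_le_of_ne (B.min'_le i (Finset.mem_of_mem_erase hi)) (Finset.ne_of_mem_erase hi).symm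
  have h1 := altSum_mem_Icc_of_antitone (B.erase m) (c := w m - δ)
    (hw.mono (by simp)) (fun i hi => h0 i (Finset.mem_of_mem_erase hi))
    (by linarith) fun i hi => hgap i (Finset.mem_of_mem_erase hi) (hm i hi)
  rw [← Finset.insert_erase (B.min'_mem hB), altSum_insert_min hm]
  linarith [h1.2]

theorem le_altSum_of_monotone {n : ℕ} {w : Fin n → ℝ} {A : Finset (Fin n)} (hA : A.Nonempty)
    {δ : ℝ} (hw : MonotoneOn w A) (h0 : ∀ i ∈ A, 0 ≤ w i) (hδ : δ ≤ w (A.max' hA))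
    (hgap : ∀ i ∈ A, i < A.max' hA → w i ≤ w (A.max' hA) - δ) :
    δ ≤ (-1) ^ (A.card + 1) * altSum A w := by
  set m := A.max' hA
  have hm : ∀ i ∈ A.erase m, i < m := fun i hi =>
    lt_of_le_of_ne (A.le_max' i (Finset.mem_of_mem_erase hi)) (Finset.ne_of_mem_erase hi)
  have h1 := altSum_mem_Icc_of_monotone (A.erase m) (c := w m - δ)
    (hw.mono (by simp)) (fun i hi => h0 i (Finset.mem_of_mem_erase hi))
    (by linarith) fun i hi => hgap i (Finset.mem_of_mem_erase hi) (hm i hi)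
  rw [← Finset.insert_erase (A.max'_mem hA), altSum_insert_max hm]
  linarith [h1.2]

/-! ### The denominator of Berrut's interpolant -/

/-- Passing z changes the sign of 1/(z - t), just when the alternating sign changes too. After a
global sign, both parts have a positive term nearest to z, so each is nonnegative and they cannot
cancel. -/
theorem neg_one_pow_mul_altSum_inv_eq {n : ℕ} {s : Finset (Fin n)} {nodes : Fin n → ℝ}
    (hn : StrictAnti nodes) {z : ℝ} (hz : ∀ i ∈ s, nodes i ≠ z) :
    ((-1) ^ (s.filter fun i => z < nodes i).card * altSum s fun i => 1 / (z - nodes i)) =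
      ((-1) ^ ((s.filter fun i => z < nodes i).card + 1) *
        altSum (s.filter fun i => z < nodes i) fun i => 1 / (nodes i - z)) +
      altSum (s.filter fun i => nodes i < z) fun i => 1 / (z - nodes i) := by
  have hs : s = (s.filter fun i => z < nodes i) ∪ (s.filter fun i => nodes i < z) := by
    ext i
    simp only [Finset.mem_union, Finset.mem_filter]
    constructor
    · intro hi
      rcases lt_or_gt_of_ne (hz i hi) with h | h
      · exact Or.inr ⟨hi, h⟩
      · exact Or.inl ⟨hi, h⟩
    · rintro (h | h) <;> exact h.1
  set A := s.filter fun i => z < nodes i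
  set B := s.filter fun i => nodes i < z
  have hAB : ∀ i ∈ A, ∀ j ∈ B, i < j := by
    intro i hi j hj
    exact hn.lt_iff_gt.1 ((Finset.mem_filter.1 hj).2.trans (Finset.mem_filter.1 hi).2)
  have hsq : ((-1 : ℝ) ^ A.card) * (-1) ^ A.card = 1 := by
    rw [← mul_pow]
    simp
  have hA : altSum A (fun i => 1 / (z - nodes i)) = -altSum A (fun i => 1 / (nodes i - z)) := by
    rw [← altSum_neg]
    refine altSum_congr fun i _ => ?_
    rw [← neg_sub (nodes i) z, one_div, one_div, inv_neg]
  rw [hs, altSum_union hAB, hA, pow_succ]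
  linear_combination (altSum B fun i => 1 / (z - nodes i)) * hsq

theorem antitoneOn_inv_sub {n : ℕ} (s : Finset (Fin n)) {nodes : Fin n → ℝ}
    (hn : StrictAnti nodes) (z : ℝ) :
    AntitoneOn (fun i => 1 / (z - nodes i)) (s.filter fun i => nodes i < z) := by
  intro i hi j hj hij
  have h1 : nodes i < z := by simpa using (Finset.mem_filter.1 (Finset.mem_coe.1 hi)).2
  have := hn.antitone hij
  exact one_div_le_one_div_of_le (by linarith) (by linarith)

theorem monotoneOn_inv_sub {n : ℕ} (s : Finset (Fin n)) {nodes : Fin n → ℝ}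
    (hn : StrictAnti nodes) (z : ℝ) :
    MonotoneOn (fun i => 1 / (nodes i - z)) (s.filter fun i => z < nodes i) := by
  intro i hi j hj hij
  have h1 : z < nodes j := by simpa using (Finset.mem_filter.1 (Finset.mem_coe.1 hj)).2
  have := hn.antitone hij
  exact one_div_le_one_div_of_le (by linarith) (by linarith)

/-- The expression d/(a(a + d)) decreases in a, so an upper bound for the distance to the nearest
node is enough. -/
theorem inv_sub_inv_add_le_of_le {a a₀ d : ℝ} (ha : 0 < a) (haa : a ≤ a₀) (hd : 0 < d) :
    1 / a₀ - 1 / (a₀ + d) ≤ 1 / a - 1 / (a + d) := by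
  have h : ∀ b : ℝ, 0 < b → 1 / b - 1 / (b + d) = d / (b * (b + d)) := by
    intro b hb
    field_simp
    ring
  have ha₀ := ha.trans_le haa
  rw [h a ha, h a₀ ha₀]
  gcongr

/-- Lower bound for the denominator in terms of a node slightly below `z`. -/
theorem le_abs_altSum_inv_of_lt {n : ℕ} {s : Finset (Fin n)} {nodes : Fin n → ℝ}
    (hn : StrictAnti nodes) {z : ℝ} (hz : ∀ i ∈ s, nodes i ≠ z) {a d : ℝ} (hd : 0 < d)
    {v : Fin n} (hv : v ∈ s) (hvz : nodes v < z) (hva : z - a ≤ nodes v)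
    (hsep : ∀ i ∈ s, ∀ j ∈ s, i < j → i ≤ v → nodes i < z → d ≤ nodes i - nodes j) :
    1 / a - 1 / (a + d) ≤ |altSum s fun i => 1 / (z - nodes i)| := by
  have hB : (s.filter fun i => nodes i < z).Nonempty := ⟨v, by simp [hv, hvz]⟩
  have hmv := (s.filter fun i => nodes i < z).min'_le v (by simp [hv, hvz])
  have hmem := (s.filter fun i => nodes i < z).min'_mem hB
  -- The nearest node below z. It satisfies m ≤ v, so separation is needed only at nodes between v
  -- and z, where the spacing is of order 1/N even though it is smaller near the end points.
  set m := (s.filter fun i => nodes i < z).min' hB with hm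
  have h1 := hn.antitone hmv
  obtain ⟨hms, hmz⟩ := Finset.mem_filter.1 hmem
  have hgap := inv_sub_inv_add_le_of_le (a := z - nodes m) (a₀ := a) (by linarith) (by linarith) hd
  have hpos : 0 ≤ 1 / (z - nodes m + d) := by
    have : 0 < z - nodes m := by linarith
    positivity
  have hBge : 1 / a - 1 / (a + d) ≤
      altSum (s.filter fun i => nodes i < z) fun i => 1 / (z - nodes i) := by
    refine le_altSum_of_antitone hB (antitoneOn_inv_sub s hn z) ?_ ?_ ?_
    · intro i hi
      have := (Finset.mem_filter.1 hi).2
      exact one_div_nonneg.2 (by linarith)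
    · simp only [← hm]
      linarith
    · intro i hi hmi
      simp only [← hm] at hmi ⊢
      have h2 := hsep m hms i (Finset.mem_filter.1 hi).1 hmi hmv hmz
      have h3 : 1 / (z - nodes i) ≤ 1 / (z - nodes m + d) :=
        one_div_le_one_div_of_le (by linarith) (by linarith)
      linarith
  -- Only nonnegativity of the other side is used; the total sum serves as an arbitrary upper bound
  -- c.
  have hA := (altSum_mem_Icc_of_monotone (s.filter fun i => z < nodes i)
    (c := ∑ i ∈ s.filter fun i => z < nodes i, 1 / (nodes i - z)) (monotoneOn_inv_sub s hn z)
    (fun i hi => one_div_nonneg.2 (by linarith [(Finset.mem_filter.1 hi).2]))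
    (Finset.sum_nonneg fun i hi => one_div_nonneg.2 (by linarith [(Finset.mem_filter.1 hi).2]))
    (fun i hi => Finset.single_le_sum (f := fun i => 1 / (nodes i - z))
      (fun i hi => one_div_nonneg.2 (by linarith [(Finset.mem_filter.1 hi).2])) hi)).1
  have hE := neg_one_pow_mul_altSum_inv_eq hn hz
  have habs : |altSum s fun i => 1 / (z - nodes i)| =
      |(-1) ^ (s.filter fun i => z < nodes i).card * altSum s fun i => 1 / (z - nodes i)| := by
    rw [abs_mul, abs_pow, abs_neg, abs_one, one_pow, one_mul]
  rw [habs, hE]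
  exact le_trans (by linarith) (le_abs_self _)

/-- Lower bound for the denominator in terms of a node slightly above `z`. -/
theorem le_abs_altSum_inv_of_gt {n : ℕ} {s : Finset (Fin n)} {nodes : Fin n → ℝ}
    (hn : StrictAnti nodes) {z : ℝ} (hz : ∀ i ∈ s, nodes i ≠ z) {a d : ℝ} (hd : 0 < d)
    {v : Fin n} (hv : v ∈ s) (hvz : z < nodes v) (hva : nodes v ≤ z + a)
    (hsep : ∀ i ∈ s, ∀ j ∈ s, i < j → d ≤ nodes i - nodes j) :
    1 / a - 1 / (a + d) ≤ |altSum s fun i => 1 / (z - nodes i)| := by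
  have hA : (s.filter fun i => z < nodes i).Nonempty := ⟨v, by simp [hv, hvz]⟩
  have hmv := (s.filter fun i => z < nodes i).le_max' v (by simp [hv, hvz])
  have hmem := (s.filter fun i => z < nodes i).max'_mem hA
  set m := (s.filter fun i => z < nodes i).max' hA with hm
  have h1 := hn.antitone hmv
  obtain ⟨hms, hmz⟩ := Finset.mem_filter.1 hmem
  have hgap := inv_sub_inv_add_le_of_le (a := nodes m - z) (a₀ := a) (by linarith) (by linarith) hd
  have hpos : 0 ≤ 1 / (nodes m - z + d) := by
    have : 0 < nodes m - z := by linarith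
    positivity
  have hAge : 1 / a - 1 / (a + d) ≤ (-1) ^ ((s.filter fun i => z < nodes i).card + 1) *
      altSum (s.filter fun i => z < nodes i) fun i => 1 / (nodes i - z) := by
    refine le_altSum_of_monotone hA (monotoneOn_inv_sub s hn z) ?_ ?_ ?_
    · intro i hi
      have := (Finset.mem_filter.1 hi).2
      exact one_div_nonneg.2 (by linarith)
    · simp only [← hm]
      linarith
    · intro i hi hmi
      simp only [← hm] at hmi ⊢
      have h2 := hsep i (Finset.mem_filter.1 hi).1 m hms hmi
      have h3 : 1 / (nodes i - z) ≤ 1 / (nodes m - z + d) :=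
        one_div_le_one_div_of_le (by linarith) (by linarith)
      linarith
  have hB := (altSum_mem_Icc_of_antitone (s.filter fun i => nodes i < z)
    (c := ∑ i ∈ s.filter fun i => nodes i < z, 1 / (z - nodes i)) (antitoneOn_inv_sub s hn z)
    (fun i hi => one_div_nonneg.2 (by linarith [(Finset.mem_filter.1 hi).2]))
    (Finset.sum_nonneg fun i hi => one_div_nonneg.2 (by linarith [(Finset.mem_filter.1 hi).2]))
    (fun i hi => Finset.single_le_sum (f := fun i => 1 / (z - nodes i))
      (fun i hi => one_div_nonneg.2 (by linarith [(Finset.mem_filter.1 hi).2])) hi)).1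
  have hE := neg_one_pow_mul_altSum_inv_eq hn hz
  have habs : |altSum s fun i => 1 / (z - nodes i)| =
      |(-1) ^ (s.filter fun i => z < nodes i).card * altSum s fun i => 1 / (z - nodes i)| := by
    rw [abs_mul, abs_pow, abs_neg, abs_one, one_pow, one_mul]
  rw [habs, hE]
  exact le_trans (by linarith) (le_abs_self _)

/-! ### The numerator of the interpolation error -/

/-- Write w as the difference of w + (L t + B + L) and L t + B + L. Both are nonnegative and
decrease along the indices, so the Leibniz criterion applies to each. -/
theorem abs_altSum_le {n : ℕ} (s : Finset (Fin n)) {nodes : Fin n → ℝ} (hn : StrictAnti nodes)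
    (hmem : ∀ i ∈ s, nodes i ∈ Icc (-1 : ℝ) 1) {w : Fin n → ℝ} {B L : ℝ} (hB : 0 ≤ B) (hL : 0 ≤ L)
    (hw : ∀ i ∈ s, |w i| ≤ B)
    (hlip : ∀ i ∈ s, ∀ j ∈ s, |w i - w j| ≤ L * |nodes i - nodes j|) :
    |altSum s w| ≤ 2 * B + 2 * L := by
  have h1 := altSum_mem_Icc_of_antitone s (w := fun i => w i + (L * nodes i + (B + L)))
    (c := 2 * B + 2 * L) (by
      intro i hi j hj hij
      have h := hlip j hj i hi
      have h2 := hn.antitone hij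
      rw [abs_of_nonpos (by linarith : nodes j - nodes i ≤ 0)] at h
      have h3 := (abs_le.1 h).2
      simp only
      linarith)
    (fun i hi => by nlinarith [(abs_le.1 (hw i hi)).1, (hmem i hi).1])
    (by linarith)
    (fun i hi => by nlinarith [(abs_le.1 (hw i hi)).2, (hmem i hi).2])
  have h2 := altSum_mem_Icc_of_antitone s (w := fun i => L * nodes i + (B + L))
    (c := B + 2 * L) (by
      intro i hi j hj hij
      have h2 := hn.antitone hij
      simp only
      nlinarith)
    (fun i hi => by nlinarith [(hmem i hi).1])
    (by linarith)
    (fun i hi => by nlinarith [(hmem i hi).2])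
  have h3 := altSum_sub s (fun i => w i + (L * nodes i + (B + L)))
    (fun i => L * nodes i + (B + L))
  simp only [add_sub_cancel_right] at h3
  rw [h3, abs_le]
  exact ⟨by linarith [h1.1, h2.2], by linarith [h1.2, h2.1]⟩

/-- In integral form g[z, s] = ∫₀¹ g'(z + r(s - z)) dr. The mean value inequality on r ∈ [0, 1]
replaces the integral. -/
theorem abs_divDiff_sub_le {g g' : ℝ → ℝ} {L : ℝ} (hL : 0 ≤ L)
    (hg : ∀ t, HasDerivAt g (g' t) t)
    (hlip : ∀ s ∈ Icc (-1 : ℝ) 1, ∀ t ∈ Icc (-1 : ℝ) 1, |g' s - g' t| ≤ L * |s - t|)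
    {z s t : ℝ} (hz : z ∈ Icc (-1 : ℝ) 1) (hs : s ∈ Icc (-1 : ℝ) 1) (ht : t ∈ Icc (-1 : ℝ) 1)
    (hsz : s ≠ z) (htz : t ≠ z) :
    |(g s - g z) / (s - z) - (g t - g z) / (t - z)| ≤ L * |s - t| := by
  have hs0 : s - z ≠ 0 := sub_ne_zero.2 hsz
  have ht0 : t - z ≠ 0 := sub_ne_zero.2 htz
  have hd : ∀ w : ℝ, w - z ≠ 0 → ∀ r : ℝ,
      HasDerivAt (fun r : ℝ => g (z + r * (w - z)) / (w - z)) (g' (z + r * (w - z))) r := by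
    intro w hw r
    have h1 : HasDerivAt (fun r : ℝ => z + r * (w - z)) (1 * (w - z)) r :=
      ((hasDerivAt_id r).mul_const _).const_add _
    have h2 := ((hg (z + r * (w - z))).comp r h1).div_const (w - z)
    rwa [one_mul, mul_div_assoc, div_self hw, mul_one] at h2
  have hmem : ∀ w ∈ Icc (-1 : ℝ) 1, ∀ r ∈ Icc (0 : ℝ) 1, z + r * (w - z) ∈ Icc (-1 : ℝ) 1 := by
    intro w hw r hr
    exact ⟨by nlinarith [hw.1, hz.1, hr.1, hr.2], by nlinarith [hw.2, hz.2, hr.1, hr.2]⟩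
  have h := norm_image_sub_le_of_norm_deriv_le_segment_01'
    (f := fun r : ℝ => g (z + r * (s - z)) / (s - z) - g (z + r * (t - z)) / (t - z))
    (f' := fun r : ℝ => g' (z + r * (s - z)) - g' (z + r * (t - z))) (C := L * |s - t|)
    (fun r _ => ((hd s hs0 r).sub (hd t ht0 r)).hasDerivWithinAt)
    (fun r hr => by
      have hr' : r ∈ Icc (0 : ℝ) 1 := ⟨hr.1, hr.2.le⟩
      refine (hlip _ (hmem s hs r hr') _ (hmem t ht r hr')).trans ?_
      rw [show z + r * (s - z) - (z + r * (t - z)) = r * (s - t) by ring, abs_mul,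
        abs_of_nonneg hr.1]
      nlinarith [mul_nonneg hL (abs_nonneg (s - t)), hr.2])
  rw [norm_eq_abs] at h
  simp only [one_mul, zero_mul, add_zero, add_sub_cancel] at h
  convert! h using 2
  ring

theorem abs_divDiff_le {g g' : ℝ → ℝ} {B : ℝ} (hg : ∀ t, HasDerivAt g (g' t) t)
    (hB : ∀ t ∈ Icc (-1 : ℝ) 1, |g' t| ≤ B) {z s : ℝ} (hz : z ∈ Icc (-1 : ℝ) 1)
    (hs : s ∈ Icc (-1 : ℝ) 1) (hsz : s ≠ z) : |(g s - g z) / (s - z)| ≤ B := by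
  have h := Convex.norm_image_sub_le_of_norm_hasDerivWithin_le (f := g) (f' := g')
    (fun t _ => (hg t).hasDerivWithinAt) hB (convex_Icc _ _) hz hs
  rw [abs_div, div_le_iff₀ (abs_pos.2 (sub_ne_zero.2 hsz))]
  exact h

/-! ### Error of Berrut's interpolant -/

/-- The weights sum to 1, so g(z) can be moved inside the sum; the factor 1/(z - t_i) then turns
each difference g(t_i) - g(z) into a divided difference. -/
theorem abs_berrut_sub_le {n : ℕ} (s : Finset (Fin n)) {nodes : Fin n → ℝ} (hn : StrictAnti nodes)
    (hmem : ∀ i ∈ s, nodes i ∈ Icc (-1 : ℝ) 1) {g g' : ℝ → ℝ} {B L δ : ℝ} (hB : 0 ≤ B)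
    (hL : 0 ≤ L) (hδ : 0 < δ) (hg : ∀ t, HasDerivAt g (g' t) t)
    (hg' : ∀ t ∈ Icc (-1 : ℝ) 1, |g' t| ≤ B)
    (hlip : ∀ s ∈ Icc (-1 : ℝ) 1, ∀ t ∈ Icc (-1 : ℝ) 1, |g' s - g' t| ≤ L * |s - t|)
    {z : ℝ} (hz : z ∈ Icc (-1 : ℝ) 1)
    (hden : (∀ i ∈ s, nodes i ≠ z) → δ ≤ |altSum s fun i => 1 / (z - nodes i)|) :
    |berrut s nodes (fun i => g (nodes i)) z - g z| ≤ (2 * B + 2 * L) / δ := by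
  by_cases h : ∃ i ∈ s, nodes i = z
  · rw [berrut, dif_pos h, h.choose_spec.2, sub_self, abs_zero]
    positivity
  · have hz' : ∀ i ∈ s, nodes i ≠ z := fun i hi hiz => h ⟨i, hi, hiz⟩
    have hD := hden hz'
    rw [berrut, dif_neg h]
    set D := altSum s fun i => 1 / (z - nodes i) with hDdef
    have hD0 : D ≠ 0 := by
      intro h0
      rw [h0, abs_zero] at hD
      linarith
    have hsum : ∑ j ∈ s, berrutSign s j / (z - nodes j) = D := by
      rw [hDdef, altSum]
      exact Finset.sum_congr rfl fun i _ => by ring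
    have hE : ∑ i ∈ s, berrutSign s i / (z - nodes i) /
        (∑ j ∈ s, berrutSign s j / (z - nodes j)) * g (nodes i) - g z =
        -(altSum s fun i => (g (nodes i) - g z) / (nodes i - z)) / D := by
      have h1 : g z = (∑ i ∈ s, berrutSign s i / (z - nodes i) * g z) / D := by
        rw [← Finset.sum_mul, hsum, mul_div_cancel_left₀ _ hD0]
      rw [hsum]
      have h0 : ∑ i ∈ s, berrutSign s i / (z - nodes i) / D * g (nodes i) =
          (∑ i ∈ s, berrutSign s i / (z - nodes i) * g (nodes i)) / D := by
        rw [Finset.sum_div]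
        exact Finset.sum_congr rfl fun i _ => by ring
      rw [h0]
      conv_lhs => rw [h1]
      rw [← sub_div, ← Finset.sum_sub_distrib, altSum,
        ← Finset.sum_neg_distrib]
      congr 1
      refine Finset.sum_congr rfl fun i hi => ?_
      have h2 : nodes i - z ≠ 0 := sub_ne_zero.2 (hz' i hi)
      have h3 : z - nodes i ≠ 0 := sub_ne_zero.2 (hz' i hi).symm
      rw [← neg_sub (nodes i) z]
      field_simp
      ring
    rw [hE, abs_div, abs_neg]
    have hN := abs_altSum_le s hn hmem (w := fun i => (g (nodes i) - g z) / (nodes i - z)) hB hL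
      (fun i hi => abs_divDiff_le hg hg' hz (hmem i hi) (hz' i hi))
      (fun i hi j hj => abs_divDiff_sub_le hL hg hlip hz (hmem i hi) (hmem j hj) (hz' i hi)
        (hz' j hj))
    exact div_le_div₀ (by positivity) hN hδ hD

/-! ### The encoder of BACC -/

theorem berrut_node {n : ℕ} {s : Finset (Fin n)} {nodes : Fin n → ℝ} (hn : StrictAnti nodes)
    (y : Fin n → ℝ) {i : Fin n} (hi : i ∈ s) : berrut s nodes y (nodes i) = y i := by
  have h : ∃ j ∈ s, nodes j = nodes i := ⟨i, hi, rfl⟩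
  rw [berrut, dif_pos h, hn.injective h.choose_spec.2]

/-- The polynomial `∑ᵢ ± yᵢ ∏_{j ≠ i} (z - tⱼ)`. -/
noncomputable def berrutPoly {n : ℕ} (nodes y : Fin n → ℝ) (z : ℝ) : ℝ :=
  ∑ i, berrutSign Finset.univ i * y i * ∏ j ∈ Finset.univ.erase i, (z - nodes j)

theorem contDiff_berrutPoly {n : ℕ} (nodes y : Fin n → ℝ) {r : WithTop ℕ∞} :
    ContDiff ℝ r (berrutPoly nodes y) := by
  unfold berrutPoly
  fun_prop

theorem berrutPoly_node {n : ℕ} (nodes y : Fin n → ℝ) (i : Fin n) :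
    berrutPoly nodes y (nodes i) =
      berrutSign Finset.univ i * y i * ∏ j ∈ Finset.univ.erase i, (nodes i - nodes j) := by
  rw [berrutPoly, Finset.sum_eq_single i]
  · intro k _ hk
    rw [Finset.prod_eq_zero (i := i) (by simp [hk.symm]) (sub_self _), mul_zero]
  · simp

theorem berrutPoly_of_ne {n : ℕ} {nodes : Fin n → ℝ} (y : Fin n → ℝ) {z : ℝ}
    (hz : ∀ i, nodes i ≠ z) :
    berrutPoly nodes y z = (∏ j, (z - nodes j)) *
      ∑ i, berrutSign Finset.univ i / (z - nodes i) * y i := by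
  rw [berrutPoly, Finset.mul_sum]
  refine Finset.sum_congr rfl fun i _ => ?_
  rw [← Finset.mul_prod_erase Finset.univ _ (Finset.mem_univ i)]
  have := sub_ne_zero.2 (hz i).symm
  field_simp

/-- Berrut's interpolant has no real poles: at a node only one product survives, and elsewhere the
denominator estimates, applied to the single node 0, are positive. -/
theorem berrutPoly_one_ne_zero {n : ℕ} (hn0 : 0 < n) {nodes : Fin n → ℝ} (hn : StrictAnti nodes)
    {d : ℝ} (hd : 0 < d) (hsep : ∀ i j, i < j → d ≤ nodes i - nodes j) (z : ℝ) :
    berrutPoly nodes (fun _ => 1) z ≠ 0 := by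
  by_cases h : ∃ i, nodes i = z
  · obtain ⟨i, rfl⟩ := h
    rw [berrutPoly_node, berrutSign]
    refine mul_ne_zero (by simp) (Finset.prod_ne_zero_iff.2 fun j hj => ?_)
    exact sub_ne_zero.2 (hn.injective.ne (Finset.ne_of_mem_erase hj).symm)
  · have hz : ∀ i, nodes i ≠ z := fun i hi => h ⟨i, hi⟩
    rw [berrutPoly_of_ne _ hz]
    refine mul_ne_zero (Finset.prod_ne_zero_iff.2 fun j _ => sub_ne_zero.2 (hz j).symm) ?_
    have hsum : ∑ i, berrutSign Finset.univ i / (z - nodes i) * 1 =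
        altSum Finset.univ fun i => 1 / (z - nodes i) :=
      Finset.sum_congr rfl fun i _ => by ring
    have hpos : ∀ a : ℝ, 0 < a → 0 < 1 / a - 1 / (a + d) := fun a ha =>
      sub_pos.2 (one_div_lt_one_div_of_lt ha (by linarith))
    rw [hsum, ← abs_pos]
    rcases lt_or_gt_of_ne (hz ⟨0, hn0⟩) with h0 | h0
    · exact (hpos (z - nodes ⟨0, hn0⟩) (by linarith)).trans_le
        (le_abs_altSum_inv_of_lt hn (fun i _ => hz i) hd (Finset.mem_univ _) h0 (by linarith)
          fun i _ j _ hij _ _ => hsep i j hij)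
    · exact (hpos (nodes ⟨0, hn0⟩ - z) (by linarith)).trans_le
        (le_abs_altSum_inv_of_gt hn (fun i _ => hz i) hd (Finset.mem_univ _) h0 (by linarith)
          fun i _ j _ hij => hsep i j hij)

/-- Multiplication by ∏(z - t_j) clears the removable singularities; this is the source of the
smoothness of the encoder. -/
theorem berrut_univ_eq {n : ℕ} {nodes : Fin n → ℝ} (hn : StrictAnti nodes) (y : Fin n → ℝ)
    (z : ℝ) :
    berrut Finset.univ nodes y z = berrutPoly nodes y z / berrutPoly nodes (fun _ => 1) z := by
  by_cases h : ∃ i, nodes i = z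
  · obtain ⟨i, rfl⟩ := h
    rw [berrut_node hn y (Finset.mem_univ i), berrutPoly_node, berrutPoly_node]
    have h1 : ∏ j ∈ Finset.univ.erase i, (nodes i - nodes j) ≠ 0 :=
      Finset.prod_ne_zero_iff.2 fun j hj =>
        sub_ne_zero.2 (hn.injective.ne (Finset.ne_of_mem_erase hj).symm)
    have h2 : berrutSign Finset.univ i ≠ 0 := by simp [berrutSign]
    field_simp
  · have hz : ∀ i, nodes i ≠ z := fun i hi => h ⟨i, hi⟩
    have h1 : ∏ j, (z - nodes j) ≠ 0 :=
      Finset.prod_ne_zero_iff.2 fun j _ => sub_ne_zero.2 (hz j).symm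
    rw [berrut, dif_neg (by simpa using h), berrutPoly_of_ne _ hz, berrutPoly_of_ne _ hz,
      mul_div_mul_left _ _ h1, Finset.sum_div]
    refine Finset.sum_congr rfl fun i _ => ?_
    simp only [mul_one]
    ring

theorem encPoint_sub_ge {K : ℕ} {i j : Fin K} (h : i < j) :
    2 * (1 / (K : ℝ)) ^ 2 ≤ encPoint K i - encPoint K j := by
  have hK : 0 < (K : ℝ) := by exact_mod_cast i.pos
  have hπ := pi_pos
  have h0 : 0 < π / (2 * K) := by positivity
  have h' : ((i : ℕ) : ℝ) + 1 ≤ ((j : ℕ) : ℝ) := by exact_mod_cast h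
  have h1 : encAngle K j - encAngle K i = (((j : ℕ) : ℝ) - (i : ℕ)) / K * π := by
    unfold encAngle
    field_simp
    ring
  have h2 : 1 / (K : ℝ) ≤ (encAngle K j - encAngle K i) / π := by
    rw [h1, mul_div_cancel_right₀ _ hπ.ne']
    gcongr
    linarith
  have h3 : 0 ≤ encAngle K j - encAngle K i := by
    rw [h1]
    have : (0 : ℝ) ≤ ((j : ℕ) : ℝ) - (i : ℕ) := by linarith
    positivity
  refine le_trans ?_ (cos_sub_cos_ge (h0.le.trans (encAngle_mem i).1) (sub_nonneg.1 h3)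
    ((encAngle_mem j).2.trans (by linarith)))
  exact mul_le_mul_of_nonneg_left (pow_le_pow_left₀ (by positivity) h2 2) zero_le_two

theorem contDiff_baccEnc {K : ℕ} (hK : 1 ≤ K) (x : Fin K → ℝ) {r : WithTop ℕ∞} :
    ContDiff ℝ r (baccEnc x) := by
  have hK' : 0 < (K : ℝ) := by exact_mod_cast hK
  have h : baccEnc x = fun z =>
      berrutPoly (encPoint K) x z / berrutPoly (encPoint K) (fun _ => 1) z :=
    funext fun z => berrut_univ_eq (encPoint_strictAnti K) x z
  rw [h]
  exact (contDiff_berrutPoly _ _).div (contDiff_berrutPoly _ _)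
    (berrutPoly_one_ne_zero hK (encPoint_strictAnti K) (d := 2 * (1 / (K : ℝ)) ^ 2)
      (by positivity) fun i j hij => encPoint_sub_ge hij)

theorem exists_deriv_bounds {g : ℝ → ℝ} (hg : ContDiff ℝ 2 g) :
    ∃ B L : ℝ, 0 ≤ B ∧ 0 ≤ L ∧ (∀ t ∈ Icc (-1 : ℝ) 1, |deriv g t| ≤ B) ∧
      ∀ s ∈ Icc (-1 : ℝ) 1, ∀ t ∈ Icc (-1 : ℝ) 1, |deriv g s - deriv g t| ≤ L * |s - t| := by
  have hg1 : ContDiff ℝ 1 (deriv g) := by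
    have : ContDiff ℝ (1 + 1) g := by simpa [one_add_one_eq_two] using hg
    exact this.deriv'
  obtain ⟨B, hB⟩ := isCompact_Icc.exists_bound_of_continuousOn (s := Icc (-1 : ℝ) 1)
    hg1.continuous.continuousOn
  obtain ⟨L, hL⟩ := isCompact_Icc.exists_bound_of_continuousOn (s := Icc (-1 : ℝ) 1)
    (hg1.continuous_deriv le_rfl).continuousOn
  have h0 : (0 : ℝ) ∈ Icc (-1 : ℝ) 1 := by constructor <;> norm_num
  refine ⟨B, L, (norm_nonneg _).trans (hB 0 h0), (norm_nonneg _).trans (hL 0 h0), hB, ?_⟩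
  intro s hs t ht
  exact Convex.norm_image_sub_le_of_norm_deriv_le
    (fun x _ => (hg1.differentiable one_ne_zero).differentiableAt) hL (convex_Icc _ _) ht hs

/-! ### Error of the decoder of BACC -/

theorem recoveryLoss_le_sq {K : ℕ} (hK : 1 ≤ K) {f : ℝ → ℝ} {x : Fin K → ℝ} {u : ℝ → ℝ} {E : ℝ}
    (h : ∀ k, |u (encPoint K k) - f (x k)| ≤ E) : recoveryLoss f x u ≤ E ^ 2 := by
  have hK' : 0 < (K : ℝ) := by exact_mod_cast hK
  rw [recoveryLoss, one_div, inv_mul_le_iff₀ hK']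
  calc ∑ k, (u (encPoint K k) - f (x k)) ^ 2 ≤ ∑ _k : Fin K, E ^ 2 :=
        Finset.sum_le_sum fun k _ => sq_le_sq' (abs_le.1 (h k)).1 (abs_le.1 (h k)).2
    _ = K * E ^ 2 := by simp

theorem inv_sub_inv_add {a d : ℝ} (ha : 0 < a) (hd : 0 < d) :
    1 / a - 1 / (a + d) = d / (a * (a + d)) := by
  field_simp
  ring

/-- Take a = Rπ/(N - 1) and d = 2 sin(θ₀/2)/(N - 1) with θ₀ = π/(2K); then d/(a(a + d)) is of order
N/R². The margin θ₀/2 in `hR` keeps the relevant nodes in the region of linear spacing. -/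
theorem le_abs_den_of_noLongGap {K N R : ℕ} (hN : 2 ≤ N) (hR1 : 1 ≤ R) {F : Finset (Fin N)}
    (hF : NoLongGap R F) (k : Fin K)
    (hR : ((R : ℝ) + 1) * (π / ((N : ℝ) - 1)) ≤ π / (2 * K) / 2)
    (hz : ∀ i ∈ F, decPoint N i ≠ encPoint K k) :
    2 * sin (π / (2 * K) / 2) * ((N : ℝ) - 1) / ((R : ℝ) ^ 2 * (π * (π + 2))) ≤
      |altSum F fun i => 1 / (encPoint K k - decPoint N i)| := by
  have hK : 0 < (K : ℝ) := by exact_mod_cast k.pos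
  have hK1 : 1 ≤ (K : ℝ) := by exact_mod_cast k.pos
  have hN' : (2 : ℝ) ≤ N := by exact_mod_cast hN
  have hn : 0 < (N : ℝ) - 1 := by linarith
  have hR1' : (1 : ℝ) ≤ R := by exact_mod_cast hR1
  have hπ := pi_pos
  set θ₀ := π / (2 * K) with hθ₀
  have hθ₀0 : 0 < θ₀ := by positivity
  have hθ₀π : θ₀ ≤ π / 2 := by
    rw [hθ₀]
    gcongr
    linarith
  set δ := π / ((N : ℝ) - 1) with hδ
  have hδ0 : 0 < δ := by positivity
  obtain ⟨⟨v, hv, hv1, hv2⟩, -⟩ := hF.exists_near hN (encAngle_mem k) (by linarith)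
  set θ := encAngle K k with hθ
  have hθm := encAngle_mem k
  rw [← hθ, ← hθ₀] at hθm
  have hs0 : 0 < sin (θ₀ / 2) := sin_pos_of_pos_of_lt_pi (by linarith) (by linarith)
  have hs1 := sin_le_one (θ₀ / 2)
  have hd : 0 < 2 * sin (θ₀ / 2) / ((N : ℝ) - 1) := by positivity
  have hlt : ∀ i : Fin N, decPoint N i < encPoint K k → θ < decAngle N i := by
    intro i hi
    by_contra! hcon
    exact absurd (cos_le_cos_of_nonneg_of_le_pi (decAngle_nonneg hN i)
      (by linarith [hθm.2]) hcon) (not_le.2 hi)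
  have hmain := le_abs_altSum_inv_of_lt (decPoint_strictAnti hN) hz (a := R * δ) hd hv
    (cos_lt_cos_of_nonneg_of_le_pi (x := θ) (by linarith [hθm.1]) (decAngle_le_pi hN v.2) hv1)
    (by
      have h1 := (abs_le.1 (abs_cos_sub_cos_le θ (decAngle N v))).2
      rw [abs_of_nonpos (by linarith)] at h1
      rw [encPoint_eq_cos, decPoint_eq_cos, ← hθ]
      linarith)
    (by
      intro i hi j hj hij hiv hiz
      have h1 := hlt i hiz
      have h2 : decAngle N i ≤ decAngle N v := by
        rcases hiv.eq_or_lt with rfl | h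
        · exact le_rfl
        · exact (by linarith : decAngle N i ≤ decAngle N i + δ).trans (decAngle_add_le hN h)
      have h3 := decAngle_add_le hN hij
      rw [← hδ] at h3
      have h4 := cos_sub_cos_ge_of_mem (θ := θ₀ / 2) (a := decAngle N i) (b := decAngle N i + δ)
        (by linarith) (by linarith [hθm.1]) (by linarith) (by linarith [hθm.2])
      have h5 : cos (decAngle N j) ≤ cos (decAngle N i + δ) :=
        cos_le_cos_of_nonneg_of_le_pi (by linarith [hθm.1]) (decAngle_le_pi hN j.2) h3
      have h6 : (decAngle N i + δ - decAngle N i) / π = 1 / ((N : ℝ) - 1) := by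
        rw [hδ, add_sub_cancel_left]
        field_simp
      rw [h6] at h4
      rw [decPoint_eq_cos, decPoint_eq_cos]
      calc 2 * sin (θ₀ / 2) / ((N : ℝ) - 1) = 2 * sin (θ₀ / 2) * (1 / ((N : ℝ) - 1)) := by ring
        _ ≤ _ := by linarith)
  refine le_trans ?_ hmain
  rw [inv_sub_inv_add (by positivity) hd]
  have hEq : 2 * sin (θ₀ / 2) / ((N : ℝ) - 1) /
      (R * δ * (R * δ + 2 * sin (θ₀ / 2) / ((N : ℝ) - 1))) =
      2 * sin (θ₀ / 2) * ((N : ℝ) - 1) / (R * π * (R * π + 2 * sin (θ₀ / 2))) := by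
    rw [hδ]
    field_simp
  rw [hEq]
  refine div_le_div_of_nonneg_left (by positivity) (by positivity) ?_
  have h7 : 2 * sin (θ₀ / 2) ≤ R * 2 := by nlinarith
  calc (R : ℝ) * π * (R * π + 2 * sin (θ₀ / 2)) ≤ R * π * (R * π + R * 2) := by gcongr
    _ = (R : ℝ) ^ 2 * (π * (π + 2)) := by ring

/-- Crude version from any single node: a = 2 is the length of the interval and d the global minimal
spacing. -/
theorem le_abs_den_of_nonempty {N : ℕ} (hN : 2 ≤ N) {F : Finset (Fin N)} (hF : F.Nonempty)
    {z : ℝ} (hzI : z ∈ Icc (-1 : ℝ) 1) (hz : ∀ i ∈ F, decPoint N i ≠ z) :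
    1 / (4 * (N : ℝ) ^ 2) ≤ |altSum F fun i => 1 / (z - decPoint N i)| := by
  have hN' : (2 : ℝ) ≤ N := by exact_mod_cast hN
  have hn : 1 ≤ (N : ℝ) - 1 := by linarith
  have hn0 : 0 < (N : ℝ) - 1 := by linarith
  have hd : 0 < 2 / ((N : ℝ) - 1) ^ 2 := by positivity
  have hd2 : 2 / ((N : ℝ) - 1) ^ 2 ≤ 2 := div_le_self zero_le_two (one_le_pow₀ hn)
  have hδ : 1 / (4 * (N : ℝ) ^ 2) ≤ 1 / 2 - 1 / (2 + 2 / ((N : ℝ) - 1) ^ 2) := by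
    rw [inv_sub_inv_add two_pos hd]
    calc 1 / (4 * (N : ℝ) ^ 2) ≤ 1 / (4 * ((N : ℝ) - 1) ^ 2) := by
          gcongr
          linarith
      _ = 2 / ((N : ℝ) - 1) ^ 2 / (2 * (2 + 2)) := by
          field_simp
          norm_num
      _ ≤ _ := by gcongr
  refine hδ.trans ?_
  obtain ⟨v, hv⟩ := hF
  have hvm := decPoint_mem_Icc v
  rcases lt_or_gt_of_ne (hz v hv) with h | h
  · exact le_abs_altSum_inv_of_lt (decPoint_strictAnti hN) hz hd hv h
      (by linarith [hvm.1, hzI.2]) fun i _ j _ hij _ _ => decPoint_sub_ge hN hij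
  · exact le_abs_altSum_inv_of_gt (decPoint_strictAnti hN) hz hd hv h
      (by linarith [hvm.2, hzI.1]) fun i _ j _ hij => decPoint_sub_ge hN hij

/-- Bounds for the approximation error of BACC, for sets of non-stragglers without long gaps and
for all sets. -/
theorem exists_baccDec_bounds {p : ℝ} (hp0 : 0 < p) (hp1 : p < 1) {K : ℕ} (hK : 1 ≤ K)
    (x : Fin K → ℝ) {f : ℝ → ℝ} (hf : ContDiff ℝ 2 f) :
    ∃ C₁ C₂ : ℝ, 0 ≤ C₁ ∧ 0 ≤ C₂ ∧ ∀ᶠ N : ℕ in atTop, ∀ F : Finset (Fin N),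
      (NoLongGap (windowLength p N) F → recoveryLoss f x (baccDec f x F) ≤ C₁ * baccRate p N) ∧
      recoveryLoss f x (baccDec f x F) ≤ C₂ * (N : ℝ) ^ 4 := by
  have hK' : 0 < (K : ℝ) := by exact_mod_cast hK
  have hK1 : 1 ≤ (K : ℝ) := by exact_mod_cast hK
  have hπ := pi_pos
  set g : ℝ → ℝ := fun z => f (baccEnc x z) with hgdef
  have hg : ContDiff ℝ 2 g := hf.comp (contDiff_baccEnc hK x)
  obtain ⟨B, L, hB, hL, hgB, hgL⟩ := exists_deriv_bounds hg
  have hgd : ∀ t, HasDerivAt g (deriv g t) t := fun t =>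
    (hg.differentiable two_ne_zero).differentiableAt.hasDerivAt
  have hgk : ∀ k, g (encPoint K k) = f (x k) := fun k => by
    rw [hgdef]
    simp only [baccEnc]
    rw [berrut_node (encPoint_strictAnti K) x (Finset.mem_univ k)]
  set s := sin (π / (2 * K) / 2) with hs
  have hs0 : 0 < s := by
    refine sin_pos_of_pos_of_lt_pi (by positivity) ?_
    rw [div_div, div_lt_iff₀ (by positivity)]
    nlinarith
  -- Chosen so that R + 1 ≤ c(N - 1) becomes (R + 1)π/(N - 1) ≤ π/(2K)/2.
  set c := π / (2 * K) / 2 / π with hc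
  have hc0 : 0 < c := by positivity
  set D := 2 * B + 2 * L with hD
  have hD0 : 0 ≤ D := by positivity
  set S := ∑ k, |f (x k)| with hS
  have hS0 : 0 ≤ S := Finset.sum_nonneg fun k _ => abs_nonneg _
  -- Here 64 = 8² comes from R ≤ 8 log N, and S covers the empty set, for which the decoder is 0.
  refine ⟨(D * (64 * (π * (π + 2))) / s) ^ 2, (D * 4 + S) ^ 2, by positivity, by positivity, ?_⟩
  filter_upwards [eventually_windowLength hp0 hp1 hc0] with N ⟨hN, hl, hR1, hRl, hRc, _⟩ F
  have hN' : (2 : ℝ) ≤ N := by exact_mod_cast hN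
  have hn0 : 0 < (N : ℝ) - 1 := by linarith
  have hdec : ∀ k, baccDec f x F (encPoint K k) - f (x k) =
      berrut F (decPoint N) (fun i => g (decPoint N i)) (encPoint K k) - g (encPoint K k) :=
    fun k => by rw [hgk, baccDec]
  constructor
  · intro hF
    have hR : ((windowLength p N : ℝ) + 1) * (π / ((N : ℝ) - 1)) ≤ π / (2 * K) / 2 := by
      calc ((windowLength p N : ℝ) + 1) * (π / ((N : ℝ) - 1))
          ≤ c * ((N : ℝ) - 1) * (π / ((N : ℝ) - 1)) := by gcongr
        _ = _ := by
          rw [hc]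
          field_simp
    have hR1' : (1 : ℝ) ≤ windowLength p N := by exact_mod_cast hR1
    have hE : ∀ k, |baccDec f x F (encPoint K k) - f (x k)| ≤
        D * (64 * (π * (π + 2))) / s * (logb (1 / p) N ^ 2 / N) := by
      intro k
      rw [hdec]
      refine (abs_berrut_sub_le F (decPoint_strictAnti hN) (fun i _ => decPoint_mem_Icc i) hB hL
        (δ := 2 * s * ((N : ℝ) - 1) / ((windowLength p N : ℝ) ^ 2 * (π * (π + 2))))
        (by positivity) hgd hgB hgL (encPoint_mem_Icc k)
        (le_abs_den_of_noLongGap hN hR1 hF k hR)).trans ?_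
      calc D / (2 * s * ((N : ℝ) - 1) / ((windowLength p N : ℝ) ^ 2 * (π * (π + 2))))
          = D * (windowLength p N : ℝ) ^ 2 * (π * (π + 2)) / (s * (2 * ((N : ℝ) - 1))) := by
            field_simp
        _ ≤ D * (8 * logb (1 / p) N) ^ 2 * (π * (π + 2)) / (s * N) := by
            gcongr
            linarith
        _ = _ := by
            field_simp
            ring
    refine (recoveryLoss_le_sq hK hE).trans (le_of_eq ?_)
    rw [baccRate]
    ring
  · have hE : ∀ k, |baccDec f x F (encPoint K k) - f (x k)| ≤ (D * 4 + S) * (N : ℝ) ^ 2 := by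
      intro k
      have hN1 : 1 ≤ (N : ℝ) ^ 2 := one_le_pow₀ (by linarith)
      rcases F.eq_empty_or_nonempty with rfl | hF
      · have h0 : baccDec f x (∅ : Finset (Fin N)) (encPoint K k) = 0 := by
          simp [baccDec, berrut]
        rw [h0, zero_sub, abs_neg]
        have h1 : |f (x k)| ≤ S :=
          Finset.single_le_sum (f := fun k => |f (x k)|) (fun k _ => abs_nonneg _)
            (Finset.mem_univ k)
        nlinarith
      · rw [hdec]
        refine (abs_berrut_sub_le F (decPoint_strictAnti hN) (fun i _ => decPoint_mem_Icc i) hB hL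
          (δ := 1 / (4 * (N : ℝ) ^ 2)) (by positivity) hgd hgB hgL (encPoint_mem_Icc k)
          (le_abs_den_of_nonempty hN hF (encPoint_mem_Icc k))).trans ?_
        calc D / (1 / (4 * (N : ℝ) ^ 2)) = D * 4 * (N : ℝ) ^ 2 := by
              field_simp
          _ ≤ _ := by
              gcongr
              linarith
    refine (recoveryLoss_le_sq hK hE).trans (le_of_eq ?_)
    ring

/-! ### Mean and high-probability bounds for BACC. -/

theorem bacc_expect_le {p : ℝ} (hp0 : 0 < p) (hp1 : p < 1) {K : ℕ} (hK : 1 ≤ K)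
    (x : Fin K → ℝ) {f : ℝ → ℝ} (hf : ContDiff ℝ 2 f) :
    ∃ (C : ℝ) (n₀ : ℕ), ∀ N : ℕ, n₀ ≤ N →
      expect p (fun F : Finset (Fin N) => recoveryLoss f x (baccDec f x F)) ≤ C * baccRate p N := by
  obtain ⟨C₁, C₂, hC₁, hC₂, h⟩ := exists_baccDec_bounds hp0 hp1 hK x hf
  refine ⟨C₁ + C₂, eventually_atTop.1 ?_⟩
  filter_upwards [h, eventually_windowLength hp0 hp1 one_pos,
    prob_not_noLongGap_windowLength_le hp0 hp1] with N hN ⟨hN2, hl, _⟩ hprob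
  have hN' : (2 : ℝ) ≤ N := by exact_mod_cast hN2
  have hrate : 0 ≤ baccRate p N := by
    have : 0 ≤ logb (1 / p) N := by linarith
    rw [baccRate]
    positivity
  calc expect p (fun F : Finset (Fin N) => recoveryLoss f x (baccDec f x F))
      ≤ C₁ * baccRate p N + C₂ * (N : ℝ) ^ 4 *
          prob p (fun F : Finset (Fin N) => ¬ NoLongGap (windowLength p N) F) :=
        expect_le_of_forall hp0 hp1 (fun F => (hN F).1)
          fun F => (hN F).2.trans (by linarith [mul_nonneg hC₁ hrate])
    _ ≤ C₁ * baccRate p N + C₂ * (N : ℝ) ^ 4 * ((N : ℝ) ^ 6)⁻¹ := by gcongr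
    _ = C₁ * baccRate p N + C₂ * (1 / (N : ℝ) ^ 2) := by
        congr 1
        field_simp
    _ ≤ C₁ * baccRate p N + C₂ * baccRate p N := by
        rw [baccRate]
        gcongr
        exact one_le_pow₀ hl
    _ = (C₁ + C₂) * baccRate p N := by ring

theorem bacc_prob_ge {p : ℝ} (hp0 : 0 < p) (hp1 : p < 1) {K : ℕ} (hK : 1 ≤ K)
    (x : Fin K → ℝ) {f : ℝ → ℝ} (hf : ContDiff ℝ 2 f) {δ : ℝ} (hδ : 0 < δ) :
    ∃ (C : ℝ) (n₀ : ℕ), ∀ N : ℕ, n₀ ≤ N →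
      1 - δ ≤ prob p (fun F : Finset (Fin N) =>
        recoveryLoss f x (baccDec f x F) ≤ C * baccRate p N) := by
  obtain ⟨C₁, C₂, hC₁, hC₂, h⟩ := exists_baccDec_bounds hp0 hp1 hK x hf
  refine ⟨C₁, eventually_atTop.1 ?_⟩
  filter_upwards [h, prob_noLongGap_windowLength_ge hp0 hp1 hδ] with N hN hprob
  exact hprob.trans (prob_mono hp0 hp1 fun F => (hN F).1)

/-! ### Weak derivatives and absolutely continuous functions -/

theorem eq_zero_of_tsupport_subset {φ : ℝ → ℝ} (h : tsupport φ ⊆ Ioo (-1) 1) {t : ℝ}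
    (ht : t ∉ Ioo (-1 : ℝ) 1) : φ t = 0 :=
  image_eq_zero_of_notMem_tsupport fun h' => ht (h h')

theorem setIntegral_Ioo_eq (F : ℝ → ℝ) :
    ∫ t in Ioo (-1 : ℝ) 1, F t = ∫ t in (-1 : ℝ)..1, F t := by
  rw [intervalIntegral.integral_of_le (by norm_num), integral_Ioc_eq_integral_Ioo]

/-- Integration by parts; the boundary terms vanish because test functions are 0 at ±1. -/
theorem hasWeakDeriv_of_absolutelyContinuous {V v : ℝ → ℝ}
    (hV : AbsolutelyContinuousOnInterval V (-1) 1)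
    (hv : ∀ᵐ t, t ∈ Ioo (-1 : ℝ) 1 → HasDerivAt V (v t) t) : HasWeakDeriv V v := by
  intro φ hφ _ hsupp
  have hφac : AbsolutelyContinuousOnInterval φ (-1) 1 :=
    (hφ.of_le (by exact_mod_cast le_top)).contDiffOn.absolutelyContinuousOnInterval
  have h := hV.integral_mul_deriv_eq_deriv_mul hφac
  rw [eq_zero_of_tsupport_subset hsupp (by simp), eq_zero_of_tsupport_subset hsupp (by simp),
    ← setIntegral_Ioo_eq, ← setIntegral_Ioo_eq] at h
  rw [h]
  simp only [mul_zero, sub_self, zero_sub, neg_inj]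
  refine setIntegral_congr_ae measurableSet_Ioo ?_
  filter_upwards [hv] with t ht htm
  rw [(ht htm).deriv]

theorem exists_abs_le_of_tsupport_subset {χ : ℝ → ℝ} (hc : HasCompactSupport χ)
    (hs : tsupport χ ⊆ Ioo (-1) 1) : ∃ r ∈ Ico (0 : ℝ) 1, ∀ t, r < |t| → χ t = 0 := by
  obtain ⟨t₀, ht₀, hmax⟩ := (hc.isCompact.insert 0).exists_isMaxOn ⟨0, mem_insert _ _⟩
    (f := fun t : ℝ => |t|) continuous_abs.continuousOn
  refine ⟨|t₀|, ⟨abs_nonneg _, ?_⟩, fun t ht => ?_⟩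
  · rcases ht₀ with rfl | h
    · simp
    · exact abs_lt.2 (hs h)
  · refine image_eq_zero_of_notMem_tsupport fun h => ?_
    exact absurd (hmax (mem_insert_of_mem _ h)) (not_le.2 ht)

/-- A test function with vanishing integral is the derivative of a test function. -/
theorem exists_primitive_test {χ : ℝ → ℝ} (hχ : ContDiff ℝ ∞ χ) (hc : HasCompactSupport χ)
    (hs : tsupport χ ⊆ Ioo (-1) 1) (h0 : ∫ t in Ioo (-1 : ℝ) 1, χ t = 0) :
    ∃ ψ : ℝ → ℝ, ContDiff ℝ ∞ ψ ∧ HasCompactSupport ψ ∧ tsupport ψ ⊆ Ioo (-1) 1 ∧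
      deriv ψ = χ := by
  obtain ⟨r, hr, hχr⟩ := exists_abs_le_of_tsupport_subset hc hs
  set ψ : ℝ → ℝ := fun t => ∫ s in (-1 : ℝ)..t, χ s with hψ
  have hint : ∀ a b : ℝ, IntervalIntegrable χ volume a b := fun a b =>
    hχ.continuous.intervalIntegrable a b
  have hder : ∀ t, HasDerivAt ψ (χ t) t := fun t =>
    intervalIntegral.integral_hasDerivAt_right (hint _ _)
      (hχ.continuous.stronglyMeasurableAtFilter _ _) hχ.continuous.continuousAt
  have hderiv : deriv ψ = χ := funext fun t => (hder t).deriv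
  -- To the right of r the primitive equals the total integral, which is 0 by assumption.
  have hzero : ∀ t, r < |t| → ψ t = 0 := by
    intro t ht
    rcases le_total 0 t with h | h
    · rw [abs_of_nonneg h] at ht
      have h1 : ∫ s in t..1, χ s = 0 := by
        rw [intervalIntegral.integral_congr (g := fun _ => (0 : ℝ))]
        · simp
        · intro s hs
          refine hχr s (lt_of_lt_of_le ?_ (le_abs_self s))
          rcases mem_uIcc.1 hs with h | h
          · linarith [h.1]
          · linarith [h.1, hr.2]
      rw [setIntegral_Ioo_eq, ← intervalIntegral.integral_add_adjacent_intervals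
        (hint (-1) t) (hint t 1), h1, add_zero] at h0
      exact h0
    · rw [abs_of_nonpos h] at ht
      rw [hψ]
      simp only
      rw [intervalIntegral.integral_congr (g := fun _ => (0 : ℝ))]
      · simp
      · intro s hs
        refine hχr s (lt_of_lt_of_le ?_ (neg_le_abs s))
        rcases mem_uIcc.1 hs with h | h
        · linarith [h.2]
        · linarith [h.2, hr.2]
  have hsub : tsupport ψ ⊆ Icc (-r) r := by
    refine closure_minimal (fun t ht => ?_) isClosed_Icc
    by_contra hcon
    exact ht (hzero t (not_le.1 fun h => hcon (abs_le.1 h)))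
  refine ⟨ψ, ?_, ?_, hsub.trans (Icc_subset_Ioo (by linarith [hr.2]) hr.2), hderiv⟩
  · rw [contDiff_infty_iff_deriv, hderiv]
    exact ⟨fun t => (hder t).differentiableAt, hχ⟩
  · exact HasCompactSupport.of_support_subset_isCompact isCompact_Icc
      ((subset_tsupport _).trans hsub)

theorem exists_test_integral_eq_one : ∃ φ : ℝ → ℝ, ContDiff ℝ ∞ φ ∧ HasCompactSupport φ ∧
    tsupport φ ⊆ Ioo (-1) 1 ∧ ∫ t in Ioo (-1 : ℝ) 1, φ t = 1 := by
  let b : ContDiffBump (0 : ℝ) := ⟨1 / 4, 1 / 2, by norm_num, by norm_num⟩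
  have hts : tsupport (b.normed volume) ⊆ Ioo (-1 : ℝ) 1 := by
    rw [b.tsupport_normed_eq, Real.closedBall_eq_Icc]
    exact Icc_subset_Ioo (by norm_num [b]) (by norm_num [b])
  refine ⟨b.normed volume, b.contDiff_normed, b.hasCompactSupport_normed, hts, ?_⟩
  rw [setIntegral_eq_integral_of_forall_compl_eq_zero
    fun t ht => eq_zero_of_tsupport_subset hts ht]
  exact b.integral_normed

theorem integrableOn_mul_of_continuous {u φ : ℝ → ℝ} (hu : IntegrableOn u (Ioo (-1) 1))
    (hφ : Continuous φ) : IntegrableOn (fun t => u t * φ t) (Ioo (-1) 1) := by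
  obtain ⟨C, hC⟩ := isCompact_Icc.exists_bound_of_continuousOn (s := Icc (-1 : ℝ) 1)
    hφ.continuousOn
  refine Integrable.mul_bdd (c := C) hu hφ.aestronglyMeasurable ?_
  filter_upwards [ae_restrict_mem measurableSet_Ioo] with t ht
  exact hC t (Ioo_subset_Icc_self ht)

/-- **Du Bois-Reymond lemma**: a function with weak derivative zero is constant. -/
theorem HasWeakDeriv.ae_eq_const {w : ℝ → ℝ} (hw : IntegrableOn w (Ioo (-1) 1))
    (h : HasWeakDeriv w 0) : ∃ c : ℝ, ∀ᵐ t, t ∈ Ioo (-1 : ℝ) 1 → w t = c := by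
  obtain ⟨φ₀, hφ₀, hφ₀c, hφ₀s, hφ₀1⟩ := exists_test_integral_eq_one
  set c := ∫ t in Ioo (-1 : ℝ) 1, w t * φ₀ t with hc
  have hwc : IntegrableOn (fun t => w t - c) (Ioo (-1) 1) :=
    hw.sub (integrableOn_const (by simp))
  refine ⟨c, ?_⟩
  have key := isOpen_Ioo.ae_eq_zero_of_integral_contDiff_smul_eq_zero (μ := volume)
    hwc.locallyIntegrableOn (fun φ hφ hφc hφs => ?_)
  · filter_upwards [key] with t ht htm
    linarith [ht htm]
  · have hz : ∀ t, t ∉ Ioo (-1 : ℝ) 1 → φ t • (w t - c) = 0 := fun t ht => by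
      rw [eq_zero_of_tsupport_subset hφs ht, zero_smul]
    rw [← setIntegral_eq_integral_of_forall_compl_eq_zero hz]
    set a := ∫ t in Ioo (-1 : ℝ) 1, φ t with ha
    have hiφ : IntegrableOn φ (Ioo (-1) 1) :=
      (hφ.continuous.integrableOn_Icc).mono_set Ioo_subset_Icc_self
    have hiφ₀ : IntegrableOn φ₀ (Ioo (-1) 1) :=
      (hφ₀.continuous.integrableOn_Icc).mono_set Ioo_subset_Icc_self
    have hsub : tsupport (fun t => φ t - a * φ₀ t) ⊆ Ioo (-1) 1 := by
      refine (tsupport_sub _ _).trans (union_subset hφs ?_)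
      exact (closure_mono (Function.support_mul_subset_right _ _)).trans hφ₀s
    -- Subtracting a φ₀ makes the integral vanish, so the difference is ψ' for a test function ψ.
    -- Testing with ψ yields ∫ w φ = a c, that is ∫ (w - c) φ = 0.
    obtain ⟨ψ, hψ, hψc, hψs, hψd⟩ := exists_primitive_test (χ := fun t => φ t - a * φ₀ t)
      (hφ.sub (contDiff_const.mul hφ₀)) (hφc.sub hφ₀c.mul_left) hsub (by
        rw [integral_sub hiφ (hiφ₀.const_mul a), integral_const_mul, hφ₀1, mul_one, sub_self])
    have hzero := h ψ hψ hψc hψs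
    rw [hψd] at hzero
    simp only [Pi.zero_apply, zero_mul, integral_zero, neg_zero] at hzero
    have h1 : ∫ t in Ioo (-1 : ℝ) 1, w t * φ t = a * c := by
      have h2 : (fun t => w t * (φ t - a * φ₀ t)) = fun t => w t * φ t - a * (w t * φ₀ t) := by
        ext t
        ring
      rw [h2, integral_sub (integrableOn_mul_of_continuous hw hφ.continuous)
        ((integrableOn_mul_of_continuous hw hφ₀.continuous).const_mul a), integral_const_mul]
        at hzero
      linarith
    have h3 : (fun t => φ t • (w t - c)) = fun t => w t * φ t - c * φ t := by
      ext t
      rw [smul_eq_mul]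
      ring
    rw [h3, integral_sub (integrableOn_mul_of_continuous hw hφ.continuous) (hiφ.const_mul c), h1,
      integral_const_mul, ← ha]
    ring

theorem HasWeakDeriv.sub {u₁ u₂ v₁ v₂ : ℝ → ℝ} (h₁ : HasWeakDeriv u₁ v₁) (h₂ : HasWeakDeriv u₂ v₂)
    (hu₁ : IntegrableOn u₁ (Ioo (-1) 1)) (hu₂ : IntegrableOn u₂ (Ioo (-1) 1))
    (hv₁ : IntegrableOn v₁ (Ioo (-1) 1)) (hv₂ : IntegrableOn v₂ (Ioo (-1) 1)) :
    HasWeakDeriv (fun t => u₁ t - u₂ t) (fun t => v₁ t - v₂ t) := by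
  intro φ hφ hc hs
  have hd : Continuous (deriv φ) := hφ.continuous_deriv (by exact_mod_cast le_top)
  simp only [sub_mul]
  rw [integral_sub (integrableOn_mul_of_continuous hu₁ hd) (integrableOn_mul_of_continuous hu₂ hd),
    integral_sub (integrableOn_mul_of_continuous hv₁ hφ.continuous)
      (integrableOn_mul_of_continuous hv₂ hφ.continuous), h₁ φ hφ hc hs, h₂ φ hφ hc hs]
  ring

/-- The primitive vanishing at `-1` of the restriction of `v` to `(-1, 1)`. -/
noncomputable def primitive (v : ℝ → ℝ) (t : ℝ) : ℝ :=
  ∫ s in (-1 : ℝ)..t, (Ioo (-1 : ℝ) 1).indicator v s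

theorem integrable_indicator_Ioo {v : ℝ → ℝ} (hv : IntegrableOn v (Ioo (-1) 1)) :
    Integrable ((Ioo (-1 : ℝ) 1).indicator v) :=
  hv.integrable_indicator measurableSet_Ioo

theorem continuous_primitive {v : ℝ → ℝ} (hv : IntegrableOn v (Ioo (-1) 1)) :
    Continuous (primitive v) :=
  intervalIntegral.continuous_primitive
    (fun _ _ => (integrable_indicator_Ioo hv).intervalIntegrable) _

theorem absolutelyContinuous_primitive {v : ℝ → ℝ} (hv : IntegrableOn v (Ioo (-1) 1)) :
    AbsolutelyContinuousOnInterval (primitive v) (-1) 1 :=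
  IntervalIntegrable.absolutelyContinuousOnInterval_intervalIntegral
    (integrable_indicator_Ioo hv).intervalIntegrable left_mem_uIcc

theorem ae_hasDerivAt_primitive {v : ℝ → ℝ} (hv : IntegrableOn v (Ioo (-1) 1)) :
    ∀ᵐ t, t ∈ Ioo (-1 : ℝ) 1 → HasDerivAt (primitive v) (v t) t := by
  filter_upwards [LocallyIntegrable.ae_hasDerivAt_integral
    (integrable_indicator_Ioo hv).locallyIntegrable]
    with t ht htm
  have := ht (-1)
  rwa [indicator_of_mem htm] at this

theorem primitive_sub_primitive {v : ℝ → ℝ} (hv : IntegrableOn v (Ioo (-1) 1)) (s t : ℝ) :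
    primitive v t - primitive v s = ∫ r in s..t, (Ioo (-1 : ℝ) 1).indicator v r :=
  intervalIntegral.integral_interval_sub_left
    (integrable_indicator_Ioo hv).intervalIntegrable
    (integrable_indicator_Ioo hv).intervalIntegrable

theorem HasWeakDeriv.ae_eq_primitive {u v : ℝ → ℝ} (h : HasWeakDeriv u v)
    (hu : IntegrableOn u (Ioo (-1) 1)) (hv : IntegrableOn v (Ioo (-1) 1)) :
    ∃ c : ℝ, ∀ᵐ t, t ∈ Ioo (-1 : ℝ) 1 → u t = c + primitive v t := by
  have hP : IntegrableOn (primitive v) (Ioo (-1) 1) :=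
    (continuous_primitive hv).integrableOn_Icc.mono_set Ioo_subset_Icc_self
  have hsub := h.sub (hasWeakDeriv_of_absolutelyContinuous (absolutelyContinuous_primitive hv)
    (ae_hasDerivAt_primitive hv)) hu hP hv hv
  simp only [sub_self] at hsub
  obtain ⟨c, hc⟩ := HasWeakDeriv.ae_eq_const (hu.sub hP) hsub
  refine ⟨c, ?_⟩
  filter_upwards [hc] with t ht htm
  have := ht htm
  simp only [Pi.sub_apply] at this
  linarith

/-! ### Functions in `H²` -/

namespace SobolevH2

theorem integrableOn_d1 (u : SobolevH2) : IntegrableOn u.d1 (Ioo (-1) 1) :=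
  u.memLp_d1.integrable one_le_two

theorem integrableOn_d2 (u : SobolevH2) : IntegrableOn u.d2 (Ioo (-1) 1) :=
  u.memLp_d2.integrable one_le_two

theorem roughness_nonneg (u : SobolevH2) : 0 ≤ u.roughness :=
  integral_nonneg fun _ => sq_nonneg _

/-- A function in `H²` is continuously differentiable, with an absolutely continuous derivative. -/
theorem exists_rep (u : SobolevH2) : ∃ (U : ℝ → ℝ) (c : ℝ),
    (∀ t, HasDerivAt U (c + primitive u.d2 t) t) ∧ EqOn u.toFun U (Icc (-1) 1) := by
  obtain ⟨c, hc⟩ := u.hasWeakDeriv_d2.ae_eq_primitive u.integrableOn_d1 u.integrableOn_d2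
  have hu : IntegrableOn u.toFun (Ioo (-1) 1) :=
    u.continuousOn_toFun.integrableOn_Icc.mono_set Ioo_subset_Icc_self
  obtain ⟨c', hc'⟩ := u.hasWeakDeriv_d1.ae_eq_primitive hu u.integrableOn_d1
  have hD : Continuous fun t => c + primitive u.d2 t :=
    continuous_const.add (continuous_primitive u.integrableOn_d2)
  have hU : ∀ t, HasDerivAt (fun t => c' + ∫ s in (-1 : ℝ)..t, (c + primitive u.d2 s))
      (c + primitive u.d2 t) t := fun t =>
    (intervalIntegral.integral_hasDerivAt_right (hD.intervalIntegrable _ _)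
      (hD.stronglyMeasurableAtFilter _ _) hD.continuousAt).const_add c'
  refine ⟨_, c, hU, ?_⟩
  have hcont : Continuous fun t => c' + ∫ s in (-1 : ℝ)..t, (c + primitive u.d2 s) :=
    continuous_iff_continuousAt.2 fun t => (hU t).continuousAt
  -- Continuity up to ±1 upgrades almost everywhere equality to equality at every point of [-1, 1].
  refine Measure.eqOn_Icc_of_ae_eq volume (by norm_num) ?_ u.continuousOn_toFun hcont.continuousOn
  rw [← restrict_Ioo_eq_restrict_Icc]
  refine (ae_restrict_iff' measurableSet_Ioo).2 ?_
  filter_upwards [hc'] with t ht htm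
  rw [ht htm, primitive]
  congr 1
  rw [intervalIntegral.integral_of_le htm.1.le, intervalIntegral.integral_of_le htm.1.le]
  refine setIntegral_congr_ae measurableSet_Ioc ?_
  filter_upwards [hc] with s hs hsm
  have hs' : s ∈ Ioo (-1 : ℝ) 1 := ⟨hsm.1, hsm.2.trans_lt htm.2⟩
  rw [indicator_of_mem hs', hs hs']

/-- The continuously differentiable extension of `u` to the real line. -/
noncomputable def ext (u : SobolevH2) : ℝ → ℝ := u.exists_rep.choose

/-- The derivative of `u.ext`. -/
noncomputable def der (u : SobolevH2) (t : ℝ) : ℝ :=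
  u.exists_rep.choose_spec.choose + primitive u.d2 t

theorem hasDerivAt_ext (u : SobolevH2) (t : ℝ) : HasDerivAt u.ext (u.der t) t :=
  u.exists_rep.choose_spec.choose_spec.1 t

theorem eqOn_ext (u : SobolevH2) : EqOn u.toFun u.ext (Icc (-1) 1) :=
  u.exists_rep.choose_spec.choose_spec.2

theorem continuous_ext (u : SobolevH2) : Continuous u.ext :=
  continuous_iff_continuousAt.2 fun t => (u.hasDerivAt_ext t).continuousAt

theorem continuous_der (u : SobolevH2) : Continuous u.der :=
  continuous_const.add (continuous_primitive u.integrableOn_d2)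

theorem absolutelyContinuous_der (u : SobolevH2) :
    AbsolutelyContinuousOnInterval u.der (-1) 1 := by
  have h : AbsolutelyContinuousOnInterval (fun _ : ℝ => u.exists_rep.choose_spec.choose) (-1) 1 :=
    (LipschitzWith.const _).lipschitzOnWith.absolutelyContinuousOnInterval
  exact h.add (absolutelyContinuous_primitive u.integrableOn_d2)

theorem ae_hasDerivAt_der (u : SobolevH2) :
    ∀ᵐ t, t ∈ Ioo (-1 : ℝ) 1 → HasDerivAt u.der (u.d2 t) t := by
  filter_upwards [ae_hasDerivAt_primitive u.integrableOn_d2] with t ht htm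
  exact (ht htm).const_add _

theorem abs_der_sub_le (u : SobolevH2) (s t : ℝ) :
    |u.der t - u.der s| ≤ √u.roughness * √|t - s| := by
  wlog hst : s ≤ t generalizing s t
  · rw [abs_sub_comm, abs_sub_comm t s]
    exact this t s (le_of_not_ge hst)
  rcases hst.eq_or_lt with rfl | hlt
  · simp
  set w := (Ioo (-1 : ℝ) 1).indicator u.d2 with hw
  have hw1 : Integrable w := integrable_indicator_Ioo u.integrableOn_d2
  have hsq : (fun r => w r ^ 2) = (Ioo (-1 : ℝ) 1).indicator fun r => u.d2 r ^ 2 := by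
    ext r
    by_cases h : r ∈ Ioo (-1 : ℝ) 1 <;> simp [hw, h]
  have hw2 : Integrable fun r => w r ^ 2 := by
    rw [hsq]
    exact IntegrableOn.integrable_indicator u.memLp_d2.integrable_sq measurableSet_Ioo
  have hR : ∫ r in s..t, w r ^ 2 ≤ u.roughness := by
    rw [roughness, ← integral_indicator measurableSet_Ioo, ← hsq,
      intervalIntegral.integral_of_le hst]
    exact setIntegral_le_integral hw2 (Eventually.of_forall fun r => sq_nonneg _)
  set I := ∫ r in s..t, w r with hI
  have hder : u.der t - u.der s = I := by
    rw [der, der, add_sub_add_left_eq_sub, primitive_sub_primitive u.integrableOn_d2]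
  have hts : 0 < t - s := sub_pos.2 hlt
  -- Cauchy-Schwarz in the form that the variance of w on [s, t] is nonnegative.
  have h0 : 0 ≤ ∫ r in s..t, (w r - I / (t - s)) ^ 2 :=
    intervalIntegral.integral_nonneg hst fun r _ => sq_nonneg _
  have h1 : ∫ r in s..t, (w r - I / (t - s)) ^ 2 = (∫ r in s..t, w r ^ 2) - I ^ 2 / (t - s) := by
    have h2 : ∀ r, (w r - I / (t - s)) ^ 2 =
        w r ^ 2 - 2 * (I / (t - s)) * w r + (I / (t - s)) ^ 2 := fun r => by ring
    simp only [h2]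
    rw [intervalIntegral.integral_add (hw2.intervalIntegrable.sub
        (hw1.const_mul _).intervalIntegrable) intervalIntegrable_const,
      intervalIntegral.integral_sub hw2.intervalIntegrable (hw1.const_mul _).intervalIntegrable,
      intervalIntegral.integral_const_mul, intervalIntegral.integral_const, ← hI, smul_eq_mul]
    field_simp
    ring
  rw [hder, ← sqrt_mul u.roughness_nonneg, abs_of_pos hts]
  refine abs_le_sqrt ?_
  rw [← div_le_iff₀ hts]
  linarith

end SobolevH2

theorem exists_mvt {e e' : ℝ → ℝ} (h : ∀ t, HasDerivAt e (e' t) t) (a b : ℝ) :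
    ∃ ξ ∈ uIcc a b, e b - e a = e' ξ * (b - a) := by
  have hc : Continuous e := continuous_iff_continuousAt.2 fun t => (h t).continuousAt
  rcases lt_trichotomy a b with hab | rfl | hab
  · obtain ⟨ξ, hξ, h1⟩ := exists_hasDerivAt_eq_slope e e' hab hc.continuousOn fun t _ => h t
    refine ⟨ξ, Ioo_subset_Icc_self.trans Icc_subset_uIcc hξ, ?_⟩
    rw [h1, div_mul_cancel₀ _ (sub_ne_zero.2 hab.ne')]
  · exact ⟨a, left_mem_uIcc, by simp⟩
  · obtain ⟨ξ, hξ, h1⟩ := exists_hasDerivAt_eq_slope e e' hab hc.continuousOn fun t _ => h t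
    refine ⟨ξ, Ioo_subset_Icc_self.trans Icc_subset_uIcc' hξ, ?_⟩
    rw [h1]
    have := sub_ne_zero.2 hab.ne'
    field_simp
    ring

/-- Two functions in `H²` that are close at two points are close everywhere. -/
theorem SobolevH2.abs_sub_le (u g : SobolevH2) {a b z c d : ℝ} (hcd : Icc c d ⊆ Icc (-1 : ℝ) 1)
    (ha : a ∈ Icc c d) (hb : b ∈ Icc c d) (hz : z ∈ Icc c d) (hab : a ≠ b) :
    |u.toFun z - g.toFun z| ≤ |u.toFun a - g.toFun a| + |z - a| *
      ((|u.toFun a - g.toFun a| + |u.toFun b - g.toFun b|) / |b - a| +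
        (√u.roughness + √g.roughness) * √(d - c)) := by
  rw [u.eqOn_ext (hcd hz), u.eqOn_ext (hcd ha), u.eqOn_ext (hcd hb), g.eqOn_ext (hcd hz),
    g.eqOn_ext (hcd ha), g.eqOn_ext (hcd hb)]
  have hder : ∀ t, HasDerivAt (fun t => u.ext t - g.ext t) (u.der t - g.der t) t :=
    fun t => (u.hasDerivAt_ext t).sub (g.hasDerivAt_ext t)
  -- The difference e = u - g has a controlled slope at some ξ between a and b, while e(z) - e(a) is
  -- governed by its slope at some ζ. The Hölder bound compares e'(ζ) with e'(ξ).
  obtain ⟨ξ, hξ, h1⟩ := exists_mvt hder a b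
  obtain ⟨ζ, hζ, h2⟩ := exists_mvt hder a z
  have hξ' : ξ ∈ Icc c d := uIcc_subset_Icc ha hb hξ
  have hζ' : ζ ∈ Icc c d := uIcc_subset_Icc ha hz hζ
  have hba : 0 < |b - a| := abs_pos.2 (sub_ne_zero.2 hab.symm)
  have h3 : |u.der ξ - g.der ξ| ≤
      (|u.ext a - g.ext a| + |u.ext b - g.ext b|) / |b - a| := by
    rw [le_div_iff₀ hba, ← abs_mul, ← h1]
    calc |u.ext b - g.ext b - (u.ext a - g.ext a)| ≤ |u.ext b - g.ext b| + |u.ext a - g.ext a| :=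
          abs_sub _ _
      _ = _ := add_comm _ _
  have hlen : √|ζ - ξ| ≤ √(d - c) := by
    refine sqrt_le_sqrt (abs_le.2 ⟨?_, ?_⟩) <;> linarith [hξ'.1, hξ'.2, hζ'.1, hζ'.2]
  have h4 : |(u.der ζ - g.der ζ) - (u.der ξ - g.der ξ)| ≤
      (√u.roughness + √g.roughness) * √(d - c) := by
    have hu := u.abs_der_sub_le ξ ζ
    have hg := g.abs_der_sub_le ξ ζ
    calc |(u.der ζ - g.der ζ) - (u.der ξ - g.der ξ)|
        = |(u.der ζ - u.der ξ) - (g.der ζ - g.der ξ)| := by congr 1; ring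
      _ ≤ |u.der ζ - u.der ξ| + |g.der ζ - g.der ξ| := abs_sub _ _
      _ ≤ (√u.roughness + √g.roughness) * √|ζ - ξ| := by linarith
      _ ≤ _ := by gcongr
  have h5 : |u.der ζ - g.der ζ| ≤ (|u.ext a - g.ext a| + |u.ext b - g.ext b|) / |b - a| +
      (√u.roughness + √g.roughness) * √(d - c) := by
    have := abs_sub_abs_le_abs_sub (u.der ζ - g.der ζ) (u.der ξ - g.der ξ)
    linarith
  have h6 : u.ext z - g.ext z = (u.ext a - g.ext a) + (u.der ζ - g.der ζ) * (z - a) := by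
    linarith
  rw [h6]
  refine (abs_add_le _ _).trans ?_
  rw [abs_mul, mul_comm |u.der ζ - g.der ζ|]
  gcongr

namespace SobolevH2

/-- A twice continuously differentiable function as an element of `H²`. -/
noncomputable def ofContDiff (w : ℝ → ℝ) (hw : ContDiff ℝ 2 w) : SobolevH2 :=
  have hw1 : ContDiff ℝ 1 (deriv w) := by
    have : ContDiff ℝ (1 + 1) w := by simpa [one_add_one_eq_two] using hw
    exact this.deriv'
  have hmem : ∀ v : ℝ → ℝ, Continuous v → MemLp v 2 (volume.restrict (Ioo (-1 : ℝ) 1)) := by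
    intro v hv
    obtain ⟨C, hC⟩ := isCompact_Icc.exists_bound_of_continuousOn (s := Icc (-1 : ℝ) 1)
      hv.continuousOn
    refine MemLp.of_bound hv.aestronglyMeasurable C ?_
    filter_upwards [ae_restrict_mem measurableSet_Ioo] with t ht
    exact hC t (Ioo_subset_Icc_self ht)
  { toFun := w
    d1 := deriv w
    d2 := deriv (deriv w)
    continuousOn_toFun := hw.continuous.continuousOn
    memLp_d1 := hmem _ hw1.continuous
    memLp_d2 := hmem _ (hw1.continuous_deriv le_rfl)
    hasWeakDeriv_d1 := hasWeakDeriv_of_absolutelyContinuous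
      (hw.of_le one_le_two).contDiffOn.absolutelyContinuousOnInterval
      (Eventually.of_forall fun _ _ =>
        (hw.differentiable two_ne_zero).differentiableAt.hasDerivAt)
    hasWeakDeriv_d2 := hasWeakDeriv_of_absolutelyContinuous
      hw1.contDiffOn.absolutelyContinuousOnInterval
      (Eventually.of_forall fun _ _ =>
        (hw1.differentiable one_ne_zero).differentiableAt.hasDerivAt) }

theorem exists_abs_der_le (u : SobolevH2) : ∃ B : ℝ, ∀ t ∈ Icc (-1 : ℝ) 1, |u.der t| ≤ B :=
  isCompact_Icc.exists_bound_of_continuousOn u.continuous_der.continuousOn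

/-- The composition of a function with bounded second derivative with a function in `H²`. -/
noncomputable def comp (u : SobolevH2) {f : ℝ → ℝ} {ν : ℝ≥0} {η : ℝ} (hfν : LipschitzWith ν f)
    (hf : Differentiable ℝ f) (hf' : Differentiable ℝ (deriv f))
    (hη : ∀ t, |deriv (deriv f) t| ≤ η) : SobolevH2 where
  toFun := fun t => f (u.ext t)
  d1 := fun t => deriv f (u.ext t) * u.der t
  d2 := fun t => deriv (deriv f) (u.ext t) * u.der t * u.der t + deriv f (u.ext t) * u.d2 t
  continuousOn_toFun := (hf.continuous.comp u.continuous_ext).continuousOn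
  memLp_d1 := by
    obtain ⟨B, hB⟩ := u.exists_abs_der_le
    refine MemLp.of_bound ((hf'.continuous.comp u.continuous_ext).mul
      u.continuous_der).aestronglyMeasurable (ν * B) ?_
    filter_upwards [ae_restrict_mem measurableSet_Ioo] with t ht
    rw [norm_mul]
    exact mul_le_mul (norm_deriv_le_of_lipschitz hfν) (hB t (Ioo_subset_Icc_self ht))
      (norm_nonneg _) ν.2
  memLp_d2 := by
    obtain ⟨B, hB⟩ := u.exists_abs_der_le
    refine MemLp.add ?_ ?_
    · refine MemLp.of_bound ((((measurable_deriv _).comp u.continuous_ext.measurable).mul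
        u.continuous_der.measurable).mul u.continuous_der.measurable).aestronglyMeasurable
        (η * B * B) ?_
      filter_upwards [ae_restrict_mem measurableSet_Ioo] with t ht
      have h1 := hB t (Ioo_subset_Icc_self ht)
      have hB0 : 0 ≤ B := (abs_nonneg _).trans h1
      have hη0 : 0 ≤ η := (abs_nonneg _).trans (hη 0)
      rw [norm_mul, norm_mul]
      exact mul_le_mul (mul_le_mul (hη _) h1 (norm_nonneg _) hη0) h1 (norm_nonneg _)
        (mul_nonneg hη0 hB0)
    · refine MemLp.of_le_mul (c := ν) u.memLp_d2
        ((hf'.continuous.comp u.continuous_ext).aestronglyMeasurable.mul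
          u.memLp_d2.aestronglyMeasurable) (Eventually.of_forall fun t => ?_)
      rw [norm_mul]
      gcongr
      exact norm_deriv_le_of_lipschitz hfν
  hasWeakDeriv_d1 := by
    have h : ∀ t, HasDerivAt (fun t => f (u.ext t)) (deriv f (u.ext t) * u.der t) t := fun t =>
      (hf _).hasDerivAt.comp t (u.hasDerivAt_ext t)
    have hd : deriv (fun t => f (u.ext t)) = fun t => deriv f (u.ext t) * u.der t :=
      funext fun t => (h t).deriv
    have hC : ContDiff ℝ 1 fun t => f (u.ext t) := by
      rw [contDiff_one_iff_deriv, hd]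
      exact ⟨fun t => (h t).differentiableAt,
        (hf'.continuous.comp u.continuous_ext).mul u.continuous_der⟩
    exact hasWeakDeriv_of_absolutelyContinuous hC.contDiffOn.absolutelyContinuousOnInterval
      (Eventually.of_forall fun t _ => h t)
  hasWeakDeriv_d2 := by
    obtain ⟨B, hB⟩ := u.exists_abs_der_le
    have h : ∀ t, HasDerivAt (fun t => deriv f (u.ext t))
        (deriv (deriv f) (u.ext t) * u.der t) t := fun t =>
      (hf' _).hasDerivAt.comp t (u.hasDerivAt_ext t)
    -- Since f'' is bounded but not assumed continuous, f' ∘ u is only Lipschitz; this suffices for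
    -- (f' ∘ u) u' to be absolutely continuous.
    have hlip : LipschitzOnWith (η * B).toNNReal (fun t => deriv f (u.ext t)) (uIcc (-1) 1) := by
      rw [uIcc_of_le (by norm_num)]
      refine Convex.lipschitzOnWith_of_nnnorm_hasDerivWithin_le (convex_Icc _ _)
        (fun t _ => (h t).hasDerivWithinAt) fun t ht => ?_
      rw [← NNReal.coe_le_coe, coe_nnnorm, norm_mul]
      exact (mul_le_mul (hη _) (hB t ht) (abs_nonneg _)
        ((abs_nonneg _).trans (hη 0))).trans (Real.le_coe_toNNReal _)
    refine hasWeakDeriv_of_absolutelyContinuous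
      (hlip.absolutelyContinuousOnInterval.mul u.absolutelyContinuous_der) ?_
    filter_upwards [u.ae_hasDerivAt_der] with t ht htm
    exact (h t).mul (ht htm)

theorem comp_toFun (u : SobolevH2) {f : ℝ → ℝ} {ν : ℝ≥0} {η : ℝ} (hfν : LipschitzWith ν f)
    (hf : Differentiable ℝ f) (hf' : Differentiable ℝ (deriv f))
    (hη : ∀ t, |deriv (deriv f) t| ≤ η) {t : ℝ} (ht : t ∈ Icc (-1 : ℝ) 1) :
    (u.comp hfν hf hf' hη).toFun t = f (u.toFun t) := by
  rw [u.eqOn_ext ht]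
  rfl

theorem roughness_comp_le (u : SobolevH2) {f : ℝ → ℝ} {ν : ℝ≥0} {η : ℝ}
    (hfν : LipschitzWith ν f) (hf : Differentiable ℝ f) (hf' : Differentiable ℝ (deriv f))
    (hη : ∀ t, |deriv (deriv f) t| ≤ η) {B : ℝ} (hB : ∀ t ∈ Icc (-1 : ℝ) 1, |u.der t| ≤ B) :
    (u.comp hfν hf hf' hη).roughness ≤ 4 * (η * B * B) ^ 2 + 2 * (ν : ℝ) ^ 2 * u.roughness := by
  have hi : IntegrableOn (fun t => u.d2 t ^ 2) (Ioo (-1) 1) := u.memLp_d2.integrable_sq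
  have hconst : IntegrableOn (fun _ : ℝ => 2 * (η * B * B) ^ 2) (Ioo (-1) 1) :=
    integrableOn_const (by simp)
  have hηB : ∀ t ∈ Ioo (-1 : ℝ) 1,
      |deriv (deriv f) (u.ext t) * u.der t * u.der t| ≤ η * B * B := by
    intro t ht
    have h1 := hB t (Ioo_subset_Icc_self ht)
    have hB0 : 0 ≤ B := (abs_nonneg _).trans h1
    have hη0 : 0 ≤ η := (abs_nonneg _).trans (hη 0)
    rw [abs_mul, abs_mul]
    exact mul_le_mul (mul_le_mul (hη _) h1 (abs_nonneg _) hη0) h1 (abs_nonneg _)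
      (mul_nonneg hη0 hB0)
  calc (u.comp hfν hf hf' hη).roughness
      ≤ ∫ t in Ioo (-1 : ℝ) 1, (2 * (η * B * B) ^ 2 + 2 * (ν : ℝ) ^ 2 * u.d2 t ^ 2) := by
        refine setIntegral_mono_on (u.comp hfν hf hf' hη).memLp_d2.integrable_sq
          (hconst.add (hi.const_mul _)) measurableSet_Ioo fun t ht => ?_
        have h1 := sq_le_sq' (abs_le.1 (hηB t ht)).1 (abs_le.1 (hηB t ht)).2
        have h2 : deriv f (u.ext t) ^ 2 ≤ (ν : ℝ) ^ 2 := by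
          have : |deriv f (u.ext t)| ≤ ν := norm_deriv_le_of_lipschitz hfν
          exact sq_le_sq' (abs_le.1 this).1 (abs_le.1 this).2
        have h3 : (deriv f (u.ext t) * u.d2 t) ^ 2 ≤ (ν : ℝ) ^ 2 * u.d2 t ^ 2 := by
          rw [mul_pow]
          gcongr
        change (deriv (deriv f) (u.ext t) * u.der t * u.der t + deriv f (u.ext t) * u.d2 t) ^ 2 ≤ _
        nlinarith [sq_nonneg (deriv (deriv f) (u.ext t) * u.der t * u.der t -
          deriv f (u.ext t) * u.d2 t)]
    _ = 4 * (η * B * B) ^ 2 + 2 * (ν : ℝ) ^ 2 * u.roughness := by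
        rw [integral_add hconst (hi.const_mul _), setIntegral_const,
          integral_const_mul, roughness]
        simp only [measureReal_def, Real.volume_Ioo]
        norm_num
        ring

end SobolevH2

/-! ### Smoothing splines -/

theorem splineObjective_of_interpolates {n : ℕ} {s : Finset (Fin n)} {nodes y : Fin n → ℝ}
    {lam : ℝ} {w : SobolevH2} (hw : ∀ i ∈ s, w.toFun (nodes i) = y i) :
    splineObjective s nodes y lam w = lam * w.roughness := by
  rw [splineObjective, Finset.sum_eq_zero fun i hi => by rw [hw i hi, sub_self, zero_pow two_ne_zero]]
  simp

theorem residual_nonneg {n : ℕ} (s : Finset (Fin n)) (nodes y : Fin n → ℝ) (u : ℝ → ℝ) :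
    0 ≤ 1 / (s.card : ℝ) * ∑ i ∈ s, (u (nodes i) - y i) ^ 2 :=
  mul_nonneg (by positivity) (Finset.sum_nonneg fun _ _ => sq_nonneg _)

theorem IsSmoothingSpline.residual_le {n : ℕ} {s : Finset (Fin n)} {nodes y : Fin n → ℝ} {lam : ℝ}
    {u w : SobolevH2} (h : IsSmoothingSpline s nodes y lam u) (hlam : 0 ≤ lam)
    (hw : ∀ i ∈ s, w.toFun (nodes i) = y i) :
    1 / (s.card : ℝ) * ∑ i ∈ s, (u.toFun (nodes i) - y i) ^ 2 ≤ lam * w.roughness := by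
  have h1 := h.1 w
  rw [splineObjective_of_interpolates hw, splineObjective] at h1
  linarith [mul_nonneg hlam u.roughness_nonneg]

/-- An interpolant w has objective λ · roughness(w). For λ > 0 compare and divide by λ; for λ = 0
both objectives vanish and the tie-breaking clause decides. -/
theorem IsSmoothingSpline.roughness_le {n : ℕ} {s : Finset (Fin n)} {nodes y : Fin n → ℝ}
    {lam : ℝ} {u w : SobolevH2} (h : IsSmoothingSpline s nodes y lam u) (hlam : 0 ≤ lam)
    (hw : ∀ i ∈ s, w.toFun (nodes i) = y i) : u.roughness ≤ w.roughness := by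
  have h1 := h.1 w
  have h0 := residual_nonneg s nodes y u.toFun
  rcases hlam.eq_or_lt with rfl | hpos
  · refine h.2 w (le_antisymm ?_ h1)
    rw [splineObjective_of_interpolates hw, splineObjective]
    linarith
  · rw [splineObjective_of_interpolates hw, splineObjective] at h1
    exact le_of_mul_le_mul_left (by linarith) hpos

theorem IsSmoothingSpline.sq_residual_le {n : ℕ} {s : Finset (Fin n)} {nodes y : Fin n → ℝ}
    {lam : ℝ} {u w : SobolevH2} (h : IsSmoothingSpline s nodes y lam u) (hlam : 0 ≤ lam)
    (hw : ∀ i ∈ s, w.toFun (nodes i) = y i) {i : Fin n} (hi : i ∈ s) :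
    (u.toFun (nodes i) - y i) ^ 2 ≤ n * (lam * w.roughness) := by
  have h1 := h.residual_le hlam hw
  have hc : 0 < (s.card : ℝ) := by exact_mod_cast Finset.card_pos.2 ⟨i, hi⟩
  have hcn : (s.card : ℝ) ≤ n := by exact_mod_cast (by simpa using Finset.card_le_univ s)
  rw [one_div, inv_mul_le_iff₀ hc] at h1
  calc (u.toFun (nodes i) - y i) ^ 2 ≤ ∑ i ∈ s, (u.toFun (nodes i) - y i) ^ 2 :=
        Finset.single_le_sum (f := fun i => (u.toFun (nodes i) - y i) ^ 2)
          (fun _ _ => sq_nonneg _) hi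
    _ ≤ _ := h1
    _ ≤ _ := by
      have := mul_nonneg hlam w.roughness_nonneg
      gcongr

/-- Bounds for the encoder spline that do not depend on the smoothing parameter. -/
theorem exists_encoder_bounds {K : ℕ} (hK : 2 ≤ K) (x : Fin K → ℝ) :
    ∃ W B : ℝ, 0 ≤ W ∧ ∀ (lam : ℝ) (u : SobolevH2), 0 ≤ lam →
      IsSmoothingSpline Finset.univ (encPoint K) x lam u →
      u.roughness ≤ W ∧ (∀ t ∈ Icc (-1 : ℝ) 1, |u.der t| ≤ B) ∧
      1 / (K : ℝ) * ∑ k, (u.toFun (encPoint K k) - x k) ^ 2 ≤ lam * W := by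
  have hK0 : 0 < (K : ℝ) := by exact_mod_cast (by omega : 0 < K)
  -- Any fixed H² interpolant of the data would do as competitor; the rational encoder is a smooth
  -- one.
  set w := SobolevH2.ofContDiff (baccEnc x) (contDiff_baccEnc (by omega) x) with hw
  have hwx : ∀ i ∈ Finset.univ, w.toFun (encPoint K i) = x i := fun i hi =>
    berrut_node (encPoint_strictAnti K) x hi
  -- Comparison with the zero function bounds the values of u at the nodes uniformly in λ.
  set z := SobolevH2.ofContDiff (fun _ => 0) contDiff_const with hz
  have hzr : z.roughness = 0 := by
    rw [SobolevH2.roughness, hz]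
    simp [SobolevH2.ofContDiff]
  set X := ∑ k, |x k| with hX
  have hX0 : 0 ≤ X := Finset.sum_nonneg fun _ _ => abs_nonneg _
  refine ⟨w.roughness, 4 * X / (2 * (1 / (K : ℝ)) ^ 2) + √w.roughness * √2,
    w.roughness_nonneg, fun lam u hlam hu => ?_⟩
  have hr := hu.roughness_le hlam hwx
  refine ⟨hr, fun t ht => ?_, by simpa using hu.residual_le hlam hwx⟩
  have hval : ∀ k, |u.toFun (encPoint K k)| ≤ 2 * X := by
    intro k
    have h1 := hu.1 z
    rw [splineObjective, splineObjective, hzr, mul_zero, add_zero] at h1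
    have h2 := mul_nonneg hlam u.roughness_nonneg
    have h3 : 1 / ((Finset.univ : Finset (Fin K)).card : ℝ) *
        ∑ i, (u.toFun (encPoint K i) - x i) ^ 2 ≤
        1 / ((Finset.univ : Finset (Fin K)).card : ℝ) *
        ∑ i, (z.toFun (encPoint K i) - x i) ^ 2 := by linarith
    have h4 := le_of_mul_le_mul_left h3 (by simpa using hK0)
    have h5 : ∑ i, (z.toFun (encPoint K i) - x i) ^ 2 ≤ X ^ 2 := by
      have : ∀ i, (z.toFun (encPoint K i) - x i) ^ 2 = |x i| ^ 2 := fun i => by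
        rw [sq_abs, hz]
        simp [SobolevH2.ofContDiff]
      simp only [this]
      exact Finset.sum_sq_le_sq_sum_of_nonneg fun i _ => abs_nonneg _
    have h6 : (u.toFun (encPoint K k) - x k) ^ 2 ≤ X ^ 2 :=
      (Finset.single_le_sum (f := fun i => (u.toFun (encPoint K i) - x i) ^ 2)
        (fun _ _ => sq_nonneg _) (Finset.mem_univ k)).trans (h4.trans h5)
    have h7 := abs_le_of_sq_le_sq h6 hX0
    have h8 : |x k| ≤ X := Finset.single_le_sum (f := fun k => |x k|) (fun _ _ => abs_nonneg _)
      (Finset.mem_univ k)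
    have h9 : |u.toFun (encPoint K k)| ≤ |u.toFun (encPoint K k) - x k| + |x k| := by
      simpa using abs_add_le (u.toFun (encPoint K k) - x k) (x k)
    linarith
  let i : Fin K := ⟨0, by omega⟩
  let j : Fin K := ⟨1, by omega⟩
  have hij : i < j := by simp [i, j]
  have hgap := encPoint_sub_ge hij
  have hd : 0 < 2 * (1 / (K : ℝ)) ^ 2 := by positivity
  -- The slope between two encoder points, available since K ≥ 2, bounds u' at one point; the Hölder
  -- estimate spreads this to [-1, 1].
  obtain ⟨ξ, hξ, h1⟩ := exists_mvt u.hasDerivAt_ext (encPoint K j) (encPoint K i)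
  have hξm : ξ ∈ Icc (-1 : ℝ) 1 :=
    uIcc_subset_Icc (encPoint_mem_Icc j) (encPoint_mem_Icc i) hξ
  rw [← u.eqOn_ext (encPoint_mem_Icc i), ← u.eqOn_ext (encPoint_mem_Icc j)] at h1
  have h2 : |u.der ξ| ≤ 4 * X / (2 * (1 / (K : ℝ)) ^ 2) := by
    rw [le_div_iff₀ hd]
    calc |u.der ξ| * (2 * (1 / (K : ℝ)) ^ 2)
        ≤ |u.der ξ| * |encPoint K i - encPoint K j| := by
          gcongr
          exact hgap.trans (le_abs_self _)
      _ = |u.toFun (encPoint K i) - u.toFun (encPoint K j)| := by rw [h1, abs_mul]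
      _ ≤ |u.toFun (encPoint K i)| + |u.toFun (encPoint K j)| := abs_sub _ _
      _ ≤ 4 * X := by linarith [hval i, hval j]
  have h3 := u.abs_der_sub_le ξ t
  have h4 : √u.roughness * √|t - ξ| ≤ √w.roughness * √2 := by
    have : |t - ξ| ≤ 2 := abs_le.2 ⟨by linarith [ht.1, hξm.2], by linarith [ht.2, hξm.1]⟩
    gcongr
  have h5 := abs_sub_abs_le_abs_sub (u.der t) (u.der ξ)
  linarith

/-! ### Error of the decoder of LeTCC -/

theorem recoveryLoss_nonneg {K : ℕ} (f : ℝ → ℝ) (x : Fin K → ℝ) (u : ℝ → ℝ) :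
    0 ≤ recoveryLoss f x u :=
  mul_nonneg (by positivity) (Finset.sum_nonneg fun _ _ => sq_nonneg _)

theorem recoveryLoss_le_add {K : ℕ} (hK : 1 ≤ K) {f : ℝ → ℝ} {x : Fin K → ℝ} {u g : ℝ → ℝ} {E : ℝ}
    (h : ∀ k, |u (encPoint K k) - g (encPoint K k)| ≤ E) :
    recoveryLoss f x u ≤ 2 * E ^ 2 + 2 * recoveryLoss f x g := by
  have hK' : 0 < (K : ℝ) := by exact_mod_cast hK
  have h1 : ∑ k, (u (encPoint K k) - f (x k)) ^ 2 ≤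
      ∑ k, (2 * E ^ 2 + 2 * (g (encPoint K k) - f (x k)) ^ 2) := by
    refine Finset.sum_le_sum fun k _ => ?_
    have := sq_le_sq' (abs_le.1 (h k)).1 (abs_le.1 (h k)).2
    nlinarith [sq_nonneg ((u (encPoint K k) - g (encPoint K k)) - (g (encPoint K k) - f (x k)))]
  rw [Finset.sum_add_distrib, Finset.sum_const, Finset.card_univ, Fintype.card_fin, nsmul_eq_mul,
    ← Finset.mul_sum] at h1
  calc recoveryLoss f x u ≤ 1 / (K : ℝ) * (K * (2 * E ^ 2) +
        2 * ∑ k, (g (encPoint K k) - f (x k)) ^ 2) := by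
        rw [recoveryLoss]
        gcongr
    _ = _ := by
        rw [recoveryLoss]
        field_simp

/-- With h = b - a the difference is at most 3r + 2√G h^(3/2). The cube of h after squaring is the
cube in the LeTCC rate. -/
theorem SobolevH2.sq_sub_le_between (u g : SobolevH2) {a b z r G : ℝ} (ha : a ∈ Icc (-1 : ℝ) 1)
    (hb : b ∈ Icc (-1 : ℝ) 1) (haz : a ≤ z) (hzb : z ≤ b) (hab : a < b)
    (hu : u.roughness ≤ G) (hg : g.roughness ≤ G) (hra : |u.toFun a - g.toFun a| ≤ r)
    (hrb : |u.toFun b - g.toFun b| ≤ r) :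
    (u.toFun z - g.toFun z) ^ 2 ≤ 18 * r ^ 2 + 8 * G * (b - a) ^ 3 := by
  have h := u.abs_sub_le g (a := a) (b := b) (z := z) (Icc_subset_Icc ha.1 hb.2)
    (left_mem_Icc.2 hab.le) (right_mem_Icc.2 hab.le) ⟨haz, hzb⟩ hab.ne
  have hba : 0 < b - a := sub_pos.2 hab
  have hr : 0 ≤ r := (abs_nonneg _).trans hra
  have hG : 0 ≤ G := g.roughness_nonneg.trans hg
  have h1 : |z - a| * ((|u.toFun a - g.toFun a| + |u.toFun b - g.toFun b|) / |b - a| +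
      (√u.roughness + √g.roughness) * √(b - a)) ≤
      (b - a) * ((r + r) / (b - a) + (√G + √G) * √(b - a)) := by
    rw [abs_of_pos hba, abs_of_nonneg (sub_nonneg.2 haz)]
    gcongr
  have h2 : (b - a) * ((r + r) / (b - a) + (√G + √G) * √(b - a)) =
      2 * r + 2 * (√G * ((b - a) * √(b - a))) := by
    field_simp
    ring
  have h3 : |u.toFun z - g.toFun z| ≤ 3 * r + 2 * (√G * ((b - a) * √(b - a))) := by linarith
  have h4 := sq_le_sq' (abs_le.1 h3).1 (abs_le.1 h3).2
  have h5 : (√G * ((b - a) * √(b - a))) ^ 2 = G * (b - a) ^ 3 := by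
    rw [mul_pow, mul_pow, sq_sqrt hG, sq_sqrt hba.le]
    ring
  nlinarith [sq_nonneg (3 * r - 2 * (√G * ((b - a) * √(b - a))))]

/-- Crude bound on all of [-1, 1], for arbitrary survivor sets; it is useful as long as r/q stays
bounded. -/
theorem SobolevH2.abs_sub_le_of_two (u g : SobolevH2) {a b z r G q : ℝ} (ha : a ∈ Icc (-1 : ℝ) 1)
    (hb : b ∈ Icc (-1 : ℝ) 1) (hz : z ∈ Icc (-1 : ℝ) 1) (hq : 0 < q) (hab : q ≤ |b - a|)
    (hu : u.roughness ≤ G) (hg : g.roughness ≤ G) (hra : |u.toFun a - g.toFun a| ≤ r)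
    (hrb : |u.toFun b - g.toFun b| ≤ r) :
    |u.toFun z - g.toFun z| ≤ r + 4 * r / q + 8 * √G := by
  have hne : a ≠ b := by
    rintro rfl
    simp at hab
    linarith
  have h := u.abs_sub_le g (a := a) (b := b) (z := z) subset_rfl ha hb hz hne
  have hr : 0 ≤ r := (abs_nonneg _).trans hra
  have hza : |z - a| ≤ 2 := abs_le.2 ⟨by linarith [hz.1, ha.2], by linarith [hz.2, ha.1]⟩
  have hs2 : √(1 - (-1)) ≤ (2 : ℝ) := by
    rw [sqrt_le_left (by norm_num)]
    norm_num
  calc |u.toFun z - g.toFun z| ≤ r + 2 * ((r + r) / q + (√G + √G) * 2) := by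
        refine h.trans ?_
        gcongr
    _ = _ := by ring

/-- Bounds for the approximation error of LeTCC, for sets of non-stragglers without long gaps and
for all sets. -/
theorem exists_leTCC_bounds {p : ℝ} (hp0 : 0 < p) (hp1 : p < 1) {K : ℕ} (hK : 2 ≤ K)
    (x : Fin K → ℝ) {f : ℝ → ℝ} {ν : ℝ≥0} {η : ℝ} (hfν : LipschitzWith ν f)
    (hf : Differentiable ℝ f) (hf' : Differentiable ℝ (deriv f))
    (hη : ∀ t, |deriv (deriv f) t| ≤ η) (A M : ℝ) :
    ∃ C₁ C₂ C₃ : ℝ, 0 ≤ C₁ ∧ 0 ≤ C₂ ∧ 0 ≤ C₃ ∧ ∀ᶠ N : ℕ in atTop, ∀ lamEnc lamDec : ℝ,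
      0 ≤ lamEnc → 0 ≤ lamDec → lamDec ≤ (N : ℝ) ^ (-6 : ℤ) →
      ∀ (enc : SobolevH2) (dec : Finset (Fin N) → SobolevH2),
      IsLeTCC f x lamEnc lamDec M enc dec →
      (∀ F, NoLongGap (windowLength p N) F → recoveryLoss f x (dec F).toFun ≤
        C₁ * leTCCRate p N + 2 * recoveryLoss f x (f ∘ enc.toFun)) ∧
      (∀ F, recoveryLoss f x (dec F).toFun ≤ C₂ + 2 * recoveryLoss f x (f ∘ enc.toFun)) ∧
      (lamEnc ≤ A * leTCCRate p N →
        2 * recoveryLoss f x (f ∘ enc.toFun) ≤ C₃ * leTCCRate p N) := by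
  have hK1 : 1 ≤ K := by omega
  have hK' : 0 < (K : ℝ) := by exact_mod_cast hK1
  have hπ := pi_pos
  obtain ⟨W, B, hW, hWB⟩ := exists_encoder_bounds hK x
  set G := 4 * (η * B * B) ^ 2 + 2 * (ν : ℝ) ^ 2 * W with hG
  have hG0 : 0 ≤ G := by positivity
  set S := ∑ k, |f (x k)| with hS
  have hS0 : 0 ≤ S := Finset.sum_nonneg fun k _ => abs_nonneg _
  set c := π / (2 * K) / π with hc
  have hc0 : 0 < c := by positivity
  -- The neighbours of α_k are at most 2R ≤ 16 log N steps apart, and π/(N - 1) ≤ 2π/N, whence 32π.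
  -- The factor 11 is 1 + 2 + 8 from the two-point bound. Absolute values appear because M and A
  -- have no prescribed sign.
  refine ⟨2 * (18 * G + 8 * G * (32 * π) ^ 3), 2 * (11 * √G) ^ 2 + (|M| + S) ^ 2,
    2 * (ν : ℝ) ^ 2 * (|A| * W), by positivity, by positivity, by positivity, ?_⟩
  filter_upwards [eventually_windowLength hp0 hp1 hc0] with N ⟨hN, hl, hR1, hRl, hRc, _⟩
    lamEnc lamDec hlE hlD hlD' enc dec hL
  have hN' : (2 : ℝ) ≤ N := by exact_mod_cast hN
  have hN0 : (0 : ℝ) < N := by linarith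
  have hn0 : 0 < (N : ℝ) - 1 := by linarith
  have hl0 : 0 ≤ logb (1 / p) N := by linarith
  have hrate : 0 ≤ leTCCRate p N := by
    rw [leTCCRate]
    positivity
  obtain ⟨hencr, hencB, hencres⟩ := hWB lamEnc enc hlE hL.encoder
  -- This interpolates the decoder's data for every `F` and is the competitor in the decoder's
  -- minimisation.
  set g := enc.comp hfν hf hf' hη with hg
  have hgr : g.roughness ≤ G := by
    refine (enc.roughness_comp_le hfν hf hf' hη hencB).trans ?_
    rw [hG]
    gcongr
  have hgv : ∀ v : Fin N, g.toFun (decPoint N v) = f (enc.toFun (decPoint N v)) := fun v =>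
    enc.comp_toFun hfν hf hf' hη (decPoint_mem_Icc v)
  have hgRL : recoveryLoss f x g.toFun = recoveryLoss f x (f ∘ enc.toFun) := by
    rw [recoveryLoss, recoveryLoss]
    congr 1
    refine Finset.sum_congr rfl fun k _ => ?_
    rw [hg, enc.comp_toFun hfν hf hf' hη (encPoint_mem_Icc k), Function.comp]
  have hdr : ∀ F : Finset (Fin N), 2 ≤ F.card → (dec F).roughness ≤ G := fun F hF =>
    ((hL.decoder F hF).roughness_le hlD fun v _ => hgv v).trans hgr
  -- A squared residual is at most N · N^(-6) · G ≤ G N^(-4). The residual is thus O(N^(-2)), the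
  -- order of the smallest node spacing, so their quotient stays bounded.
  have hres : ∀ F : Finset (Fin N), 2 ≤ F.card → ∀ v ∈ F,
      |(dec F).toFun (decPoint N v) - g.toFun (decPoint N v)| ≤ √G / (N : ℝ) ^ 2 := by
    intro F hF v hv
    have h1 := (hL.decoder F hF).sq_residual_le hlD (w := g) (fun v _ => hgv v) hv
    rw [← hgv] at h1
    refine abs_le_of_sq_le_sq' ?_ (by positivity) |> abs_le.2
    refine h1.trans ?_
    calc (N : ℝ) * (lamDec * g.roughness) ≤ N * ((N : ℝ) ^ (-6 : ℤ) * G) := by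
          have := g.roughness_nonneg
          gcongr
      _ = G / (N : ℝ) ^ 5 := by
          rw [zpow_neg, show (6 : ℤ) = (6 : ℕ) by norm_num, zpow_natCast]
          field_simp
      _ ≤ G / (N : ℝ) ^ 4 := by
          gcongr
          · linarith
          · norm_num
      _ = (√G / (N : ℝ) ^ 2) ^ 2 := by
          rw [div_pow, sq_sqrt hG0]
          ring
  refine ⟨fun F hF => ?_, fun F => ?_, fun hA => ?_⟩
  · have hR : ((windowLength p N : ℝ) + 1) * (π / ((N : ℝ) - 1)) ≤ π / (2 * K) := by
      calc ((windowLength p N : ℝ) + 1) * (π / ((N : ℝ) - 1))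
          ≤ c * ((N : ℝ) - 1) * (π / ((N : ℝ) - 1)) := by gcongr
        _ = _ := by
          rw [hc]
          field_simp
    have hE : ∀ k, |(dec F).toFun (encPoint K k) - g.toFun (encPoint K k)| ≤
        √((18 * G + 8 * G * (32 * π) ^ 3) * leTCCRate p N) := by
      intro k
      refine abs_le_sqrt ?_
      obtain ⟨⟨v, hv, hv1, hv2⟩, ⟨w, hw, hw1, hw2⟩⟩ := hF.exists_near hN (encAngle_mem k) hR
      have hθ := encAngle_mem k
      have hθ0 : 0 < π / (2 * (K : ℝ)) := by positivity
      have hvz : decPoint N v < encPoint K k :=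
        cos_lt_cos_of_nonneg_of_le_pi (x := encAngle K k) (by linarith [hθ.1])
          (decAngle_le_pi hN v.2) hv1
      have hwz : encPoint K k ≤ decPoint N w :=
        cos_le_cos_of_nonneg_of_le_pi (y := encAngle K k) (decAngle_nonneg hN w)
          (by linarith [hθ.2]) hw2
      have hne : v ≠ w := by
        rintro rfl
        linarith
      have hcard : 2 ≤ F.card := Finset.one_lt_card.2 ⟨v, hv, w, hw, hne⟩
      have hlen : decPoint N w - decPoint N v ≤ 32 * π * (logb (1 / p) N / N) := by
        calc decPoint N w - decPoint N v ≤ |decAngle N w - decAngle N v| :=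
              (le_abs_self _).trans (abs_cos_sub_cos_le _ _)
          _ = decAngle N v - decAngle N w := by
              rw [abs_of_nonpos (by linarith)]
              ring
          _ ≤ 2 * (windowLength p N : ℝ) * (π / ((N : ℝ) - 1)) := by linarith
          _ ≤ 2 * (8 * logb (1 / p) N) * (π / ((N : ℝ) / 2)) := by
              gcongr
              linarith
          _ = _ := by
              field_simp
              ring
      have h1 := (dec F).sq_sub_le_between g (decPoint_mem_Icc v) (decPoint_mem_Icc w)
        hvz.le hwz (hvz.trans_le hwz) (hdr F hcard) hgr (hres F hcard v hv) (hres F hcard w hw)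
      have h2 : (√G / (N : ℝ) ^ 2) ^ 2 ≤ G * leTCCRate p N := by
        calc (√G / (N : ℝ) ^ 2) ^ 2 = G * (1 / (N : ℝ) ^ 4) := by
              rw [div_pow, sq_sqrt hG0]
              ring
          _ ≤ G * (logb (1 / p) N ^ 3 / (N : ℝ) ^ 3) := by
              gcongr
              · exact one_le_pow₀ hl
              · linarith
              · norm_num
      have h3 : (decPoint N w - decPoint N v) ^ 3 ≤ (32 * π) ^ 3 * leTCCRate p N := by
        calc (decPoint N w - decPoint N v) ^ 3 ≤ (32 * π * (logb (1 / p) N / N)) ^ 3 :=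
              pow_le_pow_left₀ (by linarith) hlen 3
          _ = _ := by
              rw [leTCCRate]
              ring
      have h4 := mul_le_mul_of_nonneg_left h3 (by positivity : 0 ≤ 8 * G)
      linarith
    have h := recoveryLoss_le_add hK1 (f := f) (x := x) hE
    rw [sq_sqrt (by positivity), hgRL] at h
    linarith
  · have hRL := recoveryLoss_nonneg f x (f ∘ enc.toFun)
    rcases lt_or_ge F.card 2 with hF | hF
    · have hE : ∀ k, |(dec F).toFun (encPoint K k) - f (x k)| ≤ |M| + S := by
        intro k
        have h1 : |f (x k)| ≤ S :=
          Finset.single_le_sum (f := fun k => |f (x k)|) (fun k _ => abs_nonneg _)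
            (Finset.mem_univ k)
        have h2 := hL.fallback F hF k
        have h3 := abs_sub ((dec F).toFun (encPoint K k)) (f (x k))
        linarith [le_abs_self M]
      have := recoveryLoss_le_sq hK1 hE
      have h0 : 0 ≤ 2 * (11 * √G) ^ 2 := by positivity
      linarith
    · obtain ⟨v, hv, w, hw, hne⟩ := Finset.one_lt_card.1 hF
      have hsep : 2 / (N : ℝ) ^ 2 ≤ |decPoint N w - decPoint N v| := by
        have h1 : 2 / (N : ℝ) ^ 2 ≤ 2 / ((N : ℝ) - 1) ^ 2 := by
          gcongr
          linarith
        refine h1.trans ?_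
        rcases lt_or_gt_of_ne hne with h | h
        · rw [abs_sub_comm]
          exact (decPoint_sub_ge hN h).trans (le_abs_self _)
        · exact (decPoint_sub_ge hN h).trans (le_abs_self _)
      have hE : ∀ k, |(dec F).toFun (encPoint K k) - g.toFun (encPoint K k)| ≤ 11 * √G := by
        intro k
        refine ((dec F).abs_sub_le_of_two g (decPoint_mem_Icc v) (decPoint_mem_Icc w)
          (encPoint_mem_Icc k) (by positivity) hsep (hdr F hF) hgr (hres F hF v hv)
          (hres F hF w hw)).trans ?_
        have h1 : √G / (N : ℝ) ^ 2 ≤ √G :=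
          div_le_self (sqrt_nonneg _) (one_le_pow₀ (by linarith))
        have h2 : 4 * (√G / (N : ℝ) ^ 2) / (2 / (N : ℝ) ^ 2) = 2 * √G := by
          field_simp
          ring
        rw [h2]
        linarith
      have h := recoveryLoss_le_add hK1 (f := f) (x := x) hE
      rw [hgRL] at h
      have h0 : 0 ≤ (|M| + S) ^ 2 := sq_nonneg _
      linarith
  · have h1 : recoveryLoss f x (f ∘ enc.toFun) ≤
        (ν : ℝ) ^ 2 * (1 / (K : ℝ) * ∑ k, (enc.toFun (encPoint K k) - x k) ^ 2) := by
      rw [recoveryLoss, mul_left_comm]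
      refine mul_le_mul_of_nonneg_left ?_ (by positivity)
      rw [Finset.mul_sum]
      refine Finset.sum_le_sum fun k _ => ?_
      have h := hfν.dist_le_mul (enc.toFun (encPoint K k)) (x k)
      rw [Real.dist_eq, Real.dist_eq] at h
      rw [← sq_abs, ← sq_abs (enc.toFun (encPoint K k) - x k), ← mul_pow]
      exact pow_le_pow_left₀ (abs_nonneg _) h 2
    have h2 : lamEnc * W ≤ |A| * W * leTCCRate p N := by
      calc lamEnc * W ≤ |A| * leTCCRate p N * W := by
            gcongr
            exact hA.trans (mul_le_mul_of_nonneg_right (le_abs_self A) hrate)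
        _ = _ := by ring
    have h3 := mul_le_mul_of_nonneg_left (hencres.trans h2) (sq_nonneg (ν : ℝ))
    linarith

/-! ### Mean and high-probability bounds for LeTCC. -/

theorem leTCC_expect_le {p : ℝ} (hp0 : 0 < p) (hp1 : p < 1) {K : ℕ} (hK : 2 ≤ K)
    (x : Fin K → ℝ) {f : ℝ → ℝ} {ν : ℝ≥0} {η : ℝ} (hfν : LipschitzWith ν f)
    (hf : Differentiable ℝ f) (hf' : Differentiable ℝ (deriv f))
    (hη : ∀ t, |deriv (deriv f) t| ≤ η) (A M : ℝ) :
    ∃ (C : ℝ) (n₀ : ℕ), ∀ N : ℕ, n₀ ≤ N → ∀ lamEnc lamDec : ℝ, 0 ≤ lamEnc → 0 ≤ lamDec →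
      lamDec ≤ (N : ℝ) ^ (-6 : ℤ) →
      ∀ (enc : SobolevH2) (dec : Finset (Fin N) → SobolevH2),
        IsLeTCC f x lamEnc lamDec M enc dec →
        expect p (fun F => recoveryLoss f x (dec F).toFun)
            ≤ C * leTCCRate p N + 2 * recoveryLoss f x (f ∘ enc.toFun) ∧
        (lamEnc ≤ A * leTCCRate p N →
          expect p (fun F => recoveryLoss f x (dec F).toFun) ≤ C * leTCCRate p N) := by
  obtain ⟨C₁, C₂, C₃, hC₁, hC₂, hC₃, h⟩ := exists_leTCC_bounds hp0 hp1 hK x hfν hf hf' hη A M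
  refine ⟨C₁ + C₂ + C₃, eventually_atTop.1 ?_⟩
  filter_upwards [h, eventually_windowLength hp0 hp1 one_pos,
    prob_not_noLongGap_windowLength_le hp0 hp1] with N hN ⟨hN2, hl, _⟩ hprob
    lamEnc lamDec hlE hlD hlD' enc dec hL
  obtain ⟨hgood, hall, hRL⟩ := hN lamEnc lamDec hlE hlD hlD' enc dec hL
  have hN' : (2 : ℝ) ≤ N := by exact_mod_cast hN2
  have hrate1 : ((N : ℝ) ^ 6)⁻¹ ≤ leTCCRate p N := by
    rw [leTCCRate, ← one_div]
    gcongr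
    · exact one_le_pow₀ hl
    · linarith
    · norm_num
  have hrate : 0 ≤ leTCCRate p N := le_trans (by positivity) hrate1
  have hmain : expect p (fun F => recoveryLoss f x (dec F).toFun) ≤
      (C₁ + C₂) * leTCCRate p N + 2 * recoveryLoss f x (f ∘ enc.toFun) := by
    have h1 := expect_le_of_forall hp0 hp1 (b := C₂) hgood
      fun F => (hall F).trans (by linarith [mul_nonneg hC₁ hrate])
    have h2 := mul_le_mul_of_nonneg_left (hprob.trans hrate1) hC₂
    linarith
  have h3 := mul_nonneg hC₃ hrate
  exact ⟨by linarith, fun hA => by linarith [hRL hA]⟩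

theorem leTCC_prob_ge {p : ℝ} (hp0 : 0 < p) (hp1 : p < 1) {K : ℕ} (hK : 2 ≤ K)
    (x : Fin K → ℝ) {f : ℝ → ℝ} {ν : ℝ≥0} {η : ℝ} (hfν : LipschitzWith ν f)
    (hf : Differentiable ℝ f) (hf' : Differentiable ℝ (deriv f))
    (hη : ∀ t, |deriv (deriv f) t| ≤ η) (A M : ℝ) {δ : ℝ} (hδ : 0 < δ) :
    ∃ (C : ℝ) (n₀ : ℕ), ∀ N : ℕ, n₀ ≤ N → ∀ lamEnc lamDec : ℝ, 0 ≤ lamEnc → 0 ≤ lamDec →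
      lamDec ≤ (N : ℝ) ^ (-6 : ℤ) →
      ∀ (enc : SobolevH2) (dec : Finset (Fin N) → SobolevH2),
        IsLeTCC f x lamEnc lamDec M enc dec →
        1 - δ ≤ prob p (fun F : Finset (Fin N) => recoveryLoss f x (dec F).toFun
            ≤ C * leTCCRate p N + 2 * recoveryLoss f x (f ∘ enc.toFun)) ∧
        (lamEnc ≤ A * leTCCRate p N →
          1 - δ ≤ prob p (fun F : Finset (Fin N) =>
            recoveryLoss f x (dec F).toFun ≤ C * leTCCRate p N)) := by
  obtain ⟨C₁, C₂, C₃, hC₁, hC₂, hC₃, h⟩ := exists_leTCC_bounds hp0 hp1 hK x hfν hf hf' hη A M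
  refine ⟨C₁ + C₃, eventually_atTop.1 ?_⟩
  filter_upwards [h, eventually_windowLength hp0 hp1 one_pos,
    prob_noLongGap_windowLength_ge hp0 hp1 hδ] with N hN ⟨hN2, hl, _⟩ hprob
    lamEnc lamDec hlE hlD hlD' enc dec hL
  obtain ⟨hgood, -, hRL⟩ := hN lamEnc lamDec hlE hlD hlD' enc dec hL
  have hrate : 0 ≤ leTCCRate p N := by
    have : 0 ≤ logb (1 / p) N := by linarith
    rw [leTCCRate]
    positivity
  have h3 := mul_nonneg hC₃ hrate
  exact ⟨hprob.trans (prob_mono hp0 hp1 fun F hF => by linarith [hgood F hF]),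
    fun hA => hprob.trans (prob_mono hp0 hp1 fun F hF => by linarith [hgood F hF, hRL hA])⟩

end CodedComputing

theorem corollary2 (p : ℝ) (hp0 : 0 < p) (hp1 : p < 1) (K : ℕ) (x : Fin K → ℝ) (f : ℝ → ℝ) :
    -- LeTCC
    (2 ≤ K → ∀ (ν : ℝ≥0) (η : ℝ), LipschitzWith ν f → Differentiable ℝ f →
      Differentiable ℝ (deriv f) → (∀ t, |deriv (deriv f) t| ≤ η) → ∀ A M : ℝ,
      -- average approximation error
      (∃ (C : ℝ) (n₀ : ℕ), ∀ N : ℕ, n₀ ≤ N → ∀ lamEnc lamDec : ℝ, 0 ≤ lamEnc → 0 ≤ lamDec →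
        lamDec ≤ (N : ℝ) ^ (-6 : ℤ) →
        ∀ (enc : CodedComputing.SobolevH2) (dec : Finset (Fin N) → CodedComputing.SobolevH2),
          CodedComputing.IsLeTCC f x lamEnc lamDec M enc dec →
          CodedComputing.expect p (fun F => CodedComputing.recoveryLoss f x (dec F).toFun)
              ≤ C * CodedComputing.leTCCRate p N
                + 2 * CodedComputing.recoveryLoss f x (f ∘ enc.toFun) ∧
          (lamEnc ≤ A * CodedComputing.leTCCRate p N →
            CodedComputing.expect p (fun F => CodedComputing.recoveryLoss f x (dec F).toFun)
              ≤ C * CodedComputing.leTCCRate p N)) ∧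
      -- approximation error, with high probability
      (∀ δ ∈ Ioo (0 : ℝ) 1, ∃ (C : ℝ) (n₀ : ℕ), ∀ N : ℕ, n₀ ≤ N →
        ∀ lamEnc lamDec : ℝ, 0 ≤ lamEnc → 0 ≤ lamDec → lamDec ≤ (N : ℝ) ^ (-6 : ℤ) →
        ∀ (enc : CodedComputing.SobolevH2) (dec : Finset (Fin N) → CodedComputing.SobolevH2),
          CodedComputing.IsLeTCC f x lamEnc lamDec M enc dec →
          1 - δ ≤ CodedComputing.prob p (fun F : Finset (Fin N) =>
            CodedComputing.recoveryLoss f x (dec F).toFun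
              ≤ C * CodedComputing.leTCCRate p N
                + 2 * CodedComputing.recoveryLoss f x (f ∘ enc.toFun)) ∧
          (lamEnc ≤ A * CodedComputing.leTCCRate p N →
            1 - δ ≤ CodedComputing.prob p (fun F : Finset (Fin N) =>
              CodedComputing.recoveryLoss f x (dec F).toFun
                ≤ C * CodedComputing.leTCCRate p N)))) ∧
    -- BACC
    (1 ≤ K → ContDiff ℝ 2 f →
      (∃ (C : ℝ) (n₀ : ℕ), ∀ N : ℕ, n₀ ≤ N →
        CodedComputing.expect p (fun F : Finset (Fin N) =>
            CodedComputing.recoveryLoss f x (CodedComputing.baccDec f x F))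
          ≤ C * CodedComputing.baccRate p N) ∧
      (∀ δ ∈ Ioo (0 : ℝ) 1, ∃ (C : ℝ) (n₀ : ℕ), ∀ N : ℕ, n₀ ≤ N →
        1 - δ ≤ CodedComputing.prob p (fun F : Finset (Fin N) =>
          CodedComputing.recoveryLoss f x (CodedComputing.baccDec f x F)
            ≤ C * CodedComputing.baccRate p N))) ∧
    -- the ratio of largest and smallest spacing of the decoder points is `O(N)` and unbounded
    ((fun N : ℕ => CodedComputing.maxGap N / CodedComputing.minGap N)
        =O[atTop] (fun N : ℕ => (N : ℝ))) ∧
    Tendsto (fun N : ℕ => CodedComputing.maxGap N / CodedComputing.minGap N) atTop atTop := by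
  refine ⟨fun hK ν η hν hf hf' hη A M => ⟨?_, fun δ hδ => ?_⟩, fun hK hf => ⟨?_, fun δ hδ => ?_⟩,
    CodedComputing.maxGap_div_minGap_isBigO, CodedComputing.tendsto_maxGap_div_minGap⟩
  · exact CodedComputing.leTCC_expect_le hp0 hp1 hK x hν hf hf' hη A M
  · exact CodedComputing.leTCC_prob_ge hp0 hp1 hK x hν hf hf' hη A M hδ.1
  · exact CodedComputing.bacc_expect_le hp0 hp1 hK x hf
  · exact CodedComputing.bacc_prob_ge hp0 hp1 hK x hf hδ.1
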